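/- \textbf{Setting.} Let $d\ge 1$ and write $\hat f(\omega)=(2\pi)^{-d/2}\int_{\mathbb R^d} f(x)e^{-i\langle x,\omega\rangle}\,dx$ for the unitary ($L^2$-)Fourier transform. For a translation-invariant kernel $\Phi(x-y)$ with continuous $\Phi\in L^2(\mathbb R^d)$ and $\hat\Phi>0$ almost everywhere, the native space $\mathcal H_\Phi$ consists of the continuous functions $f\in L^2(\mathbb R^d)$, real-valued, with $\|f\|_\Phi^2=(2\pi)^{-d/2}\int |\hat f|^2/\hat\Phi\,d\omega<\infty$. Put $\Phi_\epsilon(x)=\Phi(\epsilon x)$ for $\epsilon>0$. For a finite set $X$ let $$P_{X,\Phi}(x)^2=\inf_{a\in\mathbb R^X}\Bigl\|\delta_x-\sum_{y\in X}a_y\delta_y\Bigr\|_\Phi^2,\qquad (\delta_x,\delta_y)_\Phi=\Phi(x-y),$$ be the squared power function. The right-hand side of the standard error bound is $P_{X,\Phi}(x)\|f\|_\Phi$, $x\in\Omega$, or, uniformly on $\Omega$, $\|P_{X,\Phi}\|_{\Omega,\infty}\|f\|_\Phi$. Let $\Omega\subset\mathbb R^d$ be bounded and satisfy an interior cone condition,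 and let $\gamma\in\mathbb R$. We consider nonempty finite sets $X\subset\Omega$ whose fill distance $h=h(X,\Omega)=\sup_{y\in\Omega}\min_{x\in X}\|x-y\|_2$ is at most $\gamma$ times their separation distance $\frac12\min_{x\ne y\in X}\|x-y\|_2$. \textbf{Theorem.} (1) Let $\beta>d$ and let $\Phi$ be a kernel of finite smoothness: $\Phi$ is continuous and in $L^2(\mathbb R^d)$, and for some positive constants, for almost every $\omega$, $\hat\Phi(\omega)$ is real with $C_0\le\hat\Phi(\omega)\le C_1$ if $\|\omega\|_2\le c$ and $c_0\|\omega\|_2^{-\beta}\le\hat\Phi(\omega)\le c_1\|\omega\|_2^{-\beta}$ if $\|\omega\|_2\ge c$. Then there are $h_0,C>0$ (depending only on $d,\Omega,\gamma,\Phi,\beta$) such that for all such $X$ with $h\le h_0$ and all $f\in\mathcal H_\Phi$: $f\in\mathcal H_{\Phi_\epsilon}$ and $P_{X,\Phi_\epsilon}$ is bounded on $\Omega$ for every $\epsilon>0$, and $$\|P_{X,\Phi_\epsilon}\|_{\Omega,\infty}\|f\|_{\Phi_\epsilon}\le C\|f\|_\Phi\ \ (0<\epsilon\le1),\qquad \|P_{X,\Phi_\epsilon}\|_{\Omega,\infty}\|f\|_{\Phi_\epsilon}\le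 C\epsilon^{\beta}\|f\|_\Phi\ \ (\epsilon\ge1).$$ That is, the bound is $O(1)$ for $\epsilon\to0$ and $O(\epsilon^\beta)$ for $\epsilon\to\infty$. (2) Let $m>d/2$ be an integer, and let $\Phi(x)=\frac{2^{1-m}}{\Gamma(m)}\|x\|_2^{m-d/2}K_{m-d/2}(\|x\|_2)$ (extended continuously to $x=0$) be the Whittle--Mat\'ern kernel of $W_2^m(\mathbb R^d)$, where $K_\nu$ is the modified Bessel function of the second kind. Put $|f|^2_{W_2^j(\mathbb R^d)}=(2\pi)^{-d/2}\int|\hat f(\omega)|^2\|\omega\|_2^{2j}\,d\omega$ and $$S_f(\epsilon)=\epsilon^{2m}\sum_{j=0}^m\binom mj\epsilon^{-2j}|f|^2_{W_2^j(\mathbb R^d)}.$$ Then there are $h_0,c,C>0$ (depending only on $d,\Omega,\gamma,m$) such that for all such $X$ with $h\le h_0$, all real-valued continuous $f\in W_2^m(\mathbb R^d)$ and all $0<\epsilon\le1$: $f\in\mathcal H_{\Phi_\epsilon}$, $P_{X,\Phi_\epsilon}$ is bounded on $\Omega$, and $$c\,h^{2m-d}S_f(\epsilon)\le\bigl(\|P_{X,\Phi_\epsilon}\|_{\Omega,\infty}\|f\|_{\Phi_\epsilon}\bigr)^2\le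 C\,h^{2m-d}S_f(\epsilon),$$ $$c\,\operatorname{dist}(x,X)^{2m-d}S_f(\epsilon)\le\bigl(P_{X,\Phi_\epsilon}(x)\|f\|_{\Phi_\epsilon}\bigr)^2\quad\text{for all }x\in\Omega.$$ In particular, for fixed $X$, the square of the uniform bound, and that of the pointwise bound at each $x\in\Omega\setminus X$, is bounded above and below by positive multiples of $S_f(\epsilon)$ as $\epsilon\to0$, with factors independent of $f$ and $\epsilon$. -/

import Mathlib

open MeasureTheory Real
open scoped FourierTransform SchwartzMap

noncomputable section

namespace RBFScaling

/-- Euclidean space `ℝ^d`. -/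
abbrev Eucl (d : ℕ) : Type := EuclideanSpace ℝ (Fin d)

variable {d : ℕ}

/-- The unitary Fourier transform `f̂(ω) = (2π)^{-d/2} ∫ f(x) e^{-i⟨x,ω⟩} dx` of a real-valued
function `f ∈ L²(ℝ^d)`, in the sense of Plancherel. It is obtained from Mathlib's `L²` transform,
whose kernel is `e^{-2πi⟨x,ω⟩}`, by the substitution `ω ↦ ω / (2π)`.
(The value is `0` for functions that are not in `L²`.) -/
def fourierHat (f : Eucl d → ℝ) : Eucl d → ℂ := by
  classical
  exact fun ω =>
    if hf : MemLp (fun x => (f x : ℂ)) 2 (volume : Measure (Eucl d)) then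
      (((2 * π) ^ (-(d : ℝ) / 2) : ℝ) : ℂ) *
        (𝓕 (hf.toLp (fun x => (f x : ℂ))) : Lp ℂ 2 (volume : Measure (Eucl d))) ((2 * π)⁻¹ • ω)
    else 0

/-- The scaled function `f_ε(x) = f(ε x)`. -/
def scaled (ε : ℝ) (f : Eucl d → ℝ) : Eucl d → ℝ := fun x => f (ε • x)

/-- `f` belongs to the global native space of the translation-invariant kernel `Φ(x - y)`:
`f` is continuous, square integrable, and `∫ |f̂|² / Φ̂` is finite. -/
def MemNative (Φ f : Eucl d → ℝ) : Prop :=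
  Continuous f ∧ MemLp f 2 (volume : Measure (Eucl d)) ∧
    Integrable (fun ω => ‖fourierHat f ω‖ ^ 2 / (fourierHat Φ ω).re) (volume : Measure (Eucl d))

/-- The native space norm, `‖f‖_Φ² = (2π)^{-d/2} ∫ |f̂(ω)|² / Φ̂(ω) dω`. -/
def nativeNorm (Φ f : Eucl d → ℝ) : ℝ :=
  √((2 * π) ^ (-(d : ℝ) / 2) * ∫ ω, ‖fourierHat f ω‖ ^ 2 / (fourierHat Φ ω).re)

/-- `Φ` is a kernel of finite smoothness with decay exponent `β`: it is continuous and in `L²`,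
its Fourier transform is real (a.e.), bounded above and below by positive constants on a ball
around the origin, and bounded above and below by positive multiples of `‖ω‖^{-β}` outside of
this ball. -/
structure IsFiniteSmoothness (Φ : Eucl d → ℝ) (β : ℝ) : Prop where
  continuous : Continuous Φ
  memLp : MemLp Φ 2 (volume : Measure (Eucl d))
  real : ∀ᵐ ω ∂(volume : Measure (Eucl d)), (fourierHat Φ ω).im = 0
  bounds : ∃ c C₀ C₁ c₀ c₁ : ℝ, 0 < c ∧ 0 < C₀ ∧ 0 < c₀ ∧
    ∀ᵐ ω ∂(volume : Measure (Eucl d)),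
      (‖ω‖ ≤ c → C₀ ≤ (fourierHat Φ ω).re ∧ (fourierHat Φ ω).re ≤ C₁) ∧
      (c ≤ ‖ω‖ → c₀ * ‖ω‖ ^ (-β) ≤ (fourierHat Φ ω).re ∧
        (fourierHat Φ ω).re ≤ c₁ * ‖ω‖ ^ (-β))

/-- The squared norm `‖δ_x - ∑_{y ∈ X} a_y δ_y‖_Φ²`, expanded by means of
`(δ_x, δ_y)_Φ = Φ(x - y)`. -/
def functionalNormSq (Φ : Eucl d → ℝ) (X : Finset (Eucl d)) (x : Eucl d) (a : Eucl d → ℝ) : ℝ :=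
  Φ (x - x) - ∑ y ∈ X, a y * Φ (x - y) - ∑ y ∈ X, a y * Φ (y - x)
    + ∑ y ∈ X, ∑ z ∈ X, a y * a z * Φ (y - z)

/-- The power function, `P_{X,Φ}(x)² = inf_a ‖δ_x - ∑_{y ∈ X} a_y δ_y‖_Φ²`. -/
def powerFunction (Φ : Eucl d → ℝ) (X : Finset (Eucl d)) (x : Eucl d) : ℝ :=
  √(⨅ a : Eucl d → ℝ, functionalNormSq Φ X x a)

/-- The right-hand side `P_{X,Φ}(x) ‖f‖_Φ` of the pointwise standard error bound. -/
def errorBound (Φ : Eucl d → ℝ) (X : Finset (Eucl d)) (f : Eucl d → ℝ) (x : Eucl d) : ℝ :=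
  powerFunction Φ X x * nativeNorm Φ f

/-- The right-hand side `‖P_{X,Φ}‖_{Ω,∞} ‖f‖_Φ` of the uniform standard error bound on `Ω`. -/
def uniformErrorBound (Ω : Set (Eucl d)) (Φ : Eucl d → ℝ) (X : Finset (Eucl d))
    (f : Eucl d → ℝ) : ℝ :=
  (⨆ x : Ω, powerFunction Φ X x) * nativeNorm Φ f

/-- The interior cone condition: with a fixed angle `θ` and a fixed radius `r`, every point of `Ω`
is the vertex of a cone with angle `θ` and radius `r` that is contained in `Ω`. -/
def InteriorCone (Ω : Set (Eucl d)) : Prop :=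
  ∃ θ r : ℝ, 0 < θ ∧ θ < π / 2 ∧ 0 < r ∧ ∀ x ∈ Ω, ∃ ξ : Eucl d, ‖ξ‖ = 1 ∧
    ∀ y : Eucl d, ‖y‖ = 1 → cos θ ≤ inner ℝ y ξ → ∀ t : ℝ, 0 ≤ t → t ≤ r → x + t • y ∈ Ω

/-- The fill distance `h(X,Ω) = sup_{y ∈ Ω} min_{x ∈ X} ‖x - y‖` (for nonempty `X`). -/
def fillDistance (Ω : Set (Eucl d)) (X : Finset (Eucl d)) : ℝ :=
  ⨆ y : Ω, Metric.infDist (y : Eucl d) (X : Set (Eucl d))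

/-- `X` is a nonempty finite subset of `Ω` that is placed uniformly with constant `γ`: the fill
distance is at most `γ` times the separation distance `½ min_{x ≠ y} ‖x - y‖`. -/
structure UniformlyPlaced (Ω : Set (Eucl d)) (γ : ℝ) (X : Finset (Eucl d)) : Prop where
  nonempty : X.Nonempty
  subset : (X : Set (Eucl d)) ⊆ Ω
  uniform : ∀ x ∈ X, ∀ y ∈ X, x ≠ y → fillDistance Ω X ≤ γ * (‖x - y‖ / 2)

/-- The modified Bessel function of the second kind,
`K_ν(r) = ∫_0^∞ e^{-r cosh t} cosh(ν t) dt` for `r > 0`. -/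
def besselK (ν r : ℝ) : ℝ :=
  ∫ t in Set.Ioi (0 : ℝ), exp (-(r * cosh t)) * cosh (ν * t)

/-- The Whittle-Matérn kernel `2^{1-m} / Γ(m) ‖x‖^{m-d/2} K_{m-d/2}(‖x‖)` of `W_2^m(ℝ^d)`; at the
origin it takes its limit `2^{-d/2} Γ(m-d/2) / Γ(m)` there. -/
def maternKernel (d m : ℕ) : Eucl d → ℝ := by
  classical
  exact fun x =>
    if x = 0 then 2 ^ (-(d : ℝ) / 2) * Gamma ((m : ℝ) - d / 2) / Gamma m
    else 2 ^ (1 - (m : ℝ)) / Gamma m * ‖x‖ ^ ((m : ℝ) - d / 2) * besselK ((m : ℝ) - d / 2) ‖x‖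

/-- `f` is (the continuous representative of) a real-valued element of `W_2^m(ℝ^d)`. -/
def MemW2 (m : ℕ) (f : Eucl d → ℝ) : Prop :=
  Continuous f ∧ ∃ hf : MemLp (fun x => (f x : ℂ)) 2 (volume : Measure (Eucl d)),
    TemperedDistribution.MemSobolev (m : ℝ) 2
      (hf.toLp (fun x => (f x : ℂ)) : 𝓢'(Eucl d, ℂ))

/-- The seminorm `|f|_{W_2^j(ℝ^d)}`, with `|f|² = (2π)^{-d/2} ∫ |f̂(ω)|² ‖ω‖^{2j} dω`. -/
def sobolevSeminorm (j : ℕ) (f : Eucl d → ℝ) : ℝ :=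
  √((2 * π) ^ (-(d : ℝ) / 2) * ∫ ω, ‖fourierHat f ω‖ ^ 2 * ‖ω‖ ^ (2 * j))

/-- The function `ε^{2m} ∑_{j=0}^m (m choose j) ε^{-2j} |f|²_{W_2^j(ℝ^d)}` of `ε`. -/
def sobolevScale (m : ℕ) (f : Eucl d → ℝ) (ε : ℝ) : ℝ :=
  ε ^ (2 * m) * ∑ j ∈ Finset.range (m + 1),
    (m.choose j : ℝ) * (ε ^ (2 * j))⁻¹ * sobolevSeminorm j f ^ 2

end RBFScaling

end

/-!
The bounds follow from two facts about a translation-invariant kernel `Φ` with integrable Fourier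
transform `ψ`, for which `Φ(z) = (2π)^{-d/2} ∫ ψ(ω) e^{i⟨ω,z⟩} dω` (`HasDensity`). First, the
quadratic form of the power function is a weighted `L²` norm on the Fourier side,
`‖δ_x - ∑ a_y δ_y‖_Φ² = (2π)^{-d/2} ∫ ψ(ω) |1 - ∑ a_y e^{i⟨ω,y-x⟩}|² dω`
(`HasDensity.functionalNormSq_eq`). Second, the scaled kernel `Φ_ε` has the Fourier transform
`ε^{-d} ψ(ω/ε)` (`HasDensity.scaled`).

*Upper bounds for the power function.* If `ψ(ω) ≤ A ‖ω‖^{-β}` on the whole space, then the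
transform of `Φ_ε` is at most `A ε^{β-d} ‖ω‖^{-β}` for every `ε > 0`. Weights `a_y` that are
bounded, live on the points at distance `O(h)` of `x` and reproduce polynomials of degree less than
`ℓ` make the trigonometric sum `O(min(1, (h‖ω‖)^ℓ))`, so for `2ℓ ≥ β` the integral is
`O((εh)^{β-d})` (`exists_powerFunction_scaled_sq_le`). Such weights exist
(`exists_local_reproduction`): the cone at `x` contains a grid of mesh size proportional to `h`,
each grid point has a point of `X` at distance at most `h`, and interpolation by polynomials of
bounded coordinate degrees on a slightly perturbed grid is stable, since the matrix of the problem
is invertible on the grid (a Kronecker power of a Vandermonde matrix) and depends continuously on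
the points.

*Lower bounds for the power function.* A bump function with value `1` at `x` whose support lies in
the ball of radius `q = dist(x, X)` is mapped to `1` by `δ_x - ∑ a_y δ_y`, whatever the weights are.
The Cauchy-Schwarz inequality on the Fourier side gives `P(x)² ≥ c T q^{2m-d}` as soon as
`ψ(ω) ≥ T (1 + ‖ω‖²)^{-m}` (`exists_le_functionalNormSq`); for the scaled Whittle-Matérn kernel
`T = ε^{2m-d}`. Since the supremum over `x` of `dist(x, X)` is the fill distance, this also bounds
the uniform error bound from below.

*Native space norms.* For finite smoothness, `ψ` is equivalent to `(1 + ‖ω‖)^{-β}`, so that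
`‖f‖_{Φ_ε}²` is at most a multiple of `ε^{d-β} ‖f‖_Φ²` for `ε ≤ 1` and of `ε^d ‖f‖_Φ²` for `ε ≥ 1`
(`MemNative.of_le`); multiplied with the bound for the power function, the powers of `ε` cancel, or
combine to `ε^β`. The Whittle-Matérn kernel has the density `(1 + ‖ω‖²)^{-m}`
(`hasDensity_maternKernel`), by writing this function as a Gamma integral of Gaussians. Hence the
binomial theorem gives `‖f‖_{Φ_ε}² = ε^{d-2m} S_f(ε)` exactly (`memNative_scaled_maternKernel`).
-/

namespace RBFScaling

variable {d : ℕ}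

/-! ### Fourier transforms of integrable square integrable functions -/

theorem integral_smul_fourierInv_eq {g Ψ : Eucl d → ℂ} (hg : Integrable g) (hΨ : Integrable Ψ) :
    ∫ x, 𝓕⁻ g x • Ψ x = ∫ x, g x • 𝓕⁻ Ψ x := by
  have h := VectorFourier.integral_fourierIntegral_smul_eq_flip (μ := (volume : Measure (Eucl d)))
    (ν := (volume : Measure (Eucl d))) (L := -innerₗ (Eucl d)) (f := g) (g := Ψ)
    Real.continuous_fourierChar (by simpa using! continuous_inner.neg) hg hΨ
  have hf : (-innerₗ (Eucl d)).flip = -innerₗ (Eucl d) := by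
    ext x y
    simp [real_inner_comm]
  rw [hf] at h
  exact h

theorem continuous_fourierInv {Ψ : Eucl d → ℂ} (hΨ : Integrable Ψ) : Continuous (𝓕⁻ Ψ) :=
  VectorFourier.fourierIntegral_continuous Real.continuous_fourierChar
    (by simpa using! continuous_inner.neg) hΨ

/-- Two locally integrable functions that define the same tempered distribution agree a.e. -/
theorem ae_eq_of_integral_schwartz {f f' : Eucl d → ℂ} (hf : LocallyIntegrable f)
    (hf' : LocallyIntegrable f')
    (h : ∀ g : 𝓢(Eucl d, ℂ), ∫ x, g x • f x = ∫ x, g x • f' x) : f =ᵐ[volume] f' := by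
  refine ae_eq_of_integral_contDiff_smul_eq hf hf' fun g hg hgc => ?_
  have hc : HasCompactSupport (fun x => (g x : ℂ)) :=
    hgc.comp_left (g := fun t : ℝ => (t : ℂ)) Complex.ofReal_zero
  have hs : ContDiff ℝ (⊤ : ℕ∞) (fun x => (g x : ℂ)) := Complex.ofRealCLM.contDiff.comp hg
  simpa using h (hc.toSchwartzMap hs)

/-- The inverse Fourier transform on `L²` is given by the Fourier integral on `L¹ ∩ L²`. -/
theorem fourierInv_toLp_ae_eq {Ψ : Eucl d → ℂ} (h1 : Integrable Ψ) (h2 : MemLp Ψ 2) :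
    ((𝓕⁻ (h2.toLp Ψ) : Lp ℂ 2 (volume : Measure (Eucl d))) : Eucl d → ℂ) =ᵐ[volume] 𝓕⁻ Ψ := by
  refine ae_eq_of_integral_schwartz
    ((Lp.memLp _).locallyIntegrable (by norm_num)) (continuous_fourierInv h1).locallyIntegrable
    fun g => ?_
  have h := Lp.fourierInv_toTemperedDistribution_eq (h2.toLp Ψ)
  have h' := DFunLike.congr_fun h g
  rw [TemperedDistribution.fourierInv_apply, Lp.toTemperedDistribution_apply,
    Lp.toTemperedDistribution_apply] at h'
  rw [← h', ← integral_smul_fourierInv_eq g.integrable h1]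
  refine integral_congr_ae ?_
  filter_upwards [h2.coeFn_toLp] with x hx
  rw [hx, SchwartzMap.fourierInv_coe]

/-- `Φ` is the inverse Fourier transform of `ψ`, in the unitary normalization. Integrability of `ψ`
is not part of the definition. -/
def HasDensity (Φ ψ : Eucl d → ℝ) : Prop :=
  ∀ z, (Φ z : ℂ) = ((2 * π) ^ (-(d : ℝ) / 2) : ℝ) *
    ∫ ω, Complex.exp (inner ℝ ω z * Complex.I) * ψ ω

theorem two_pi_rpow_mul : ((2 * π) ^ (-(d : ℝ) / 2) : ℝ) * (2 * π) ^ ((d : ℝ) / 2) = 1 := by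
  rw [← Real.rpow_add (by positivity), neg_div, neg_add_cancel, Real.rpow_zero]

/-- The inverse transform in the unitary normalization, as Mathlib's inverse transform of a dilated
density. -/
theorem unitary_integral_eq_fourierInv (ψ : Eucl d → ℝ) (z : Eucl d) :
    (((2 * π) ^ (-(d : ℝ) / 2) : ℝ) : ℂ) * ∫ ω, Complex.exp (inner ℝ ω z * Complex.I) * ψ ω =
      𝓕⁻ (fun η : Eucl d => (((2 * π) ^ ((d : ℝ) / 2) * ψ ((2 * π) • η) : ℝ) : ℂ)) z := by
  rw [Real.fourierInv_eq']
  have hs := Measure.integral_comp_smul (volume : Measure (Eucl d))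
    (fun ω => Complex.exp (inner ℝ ω z * Complex.I) * ψ ω) (2 * π)
  have e1 : (2 * π : ℝ) ^ (-(d : ℝ) / 2) = (2 * π) ^ ((d : ℝ) / 2) * ((2 * π) ^ d)⁻¹ := by
    rw [← Real.rpow_natCast, ← Real.rpow_neg (by positivity), ← Real.rpow_add (by positivity)]
    congr 1; ring
  have e2 : |((2 * π : ℝ) ^ Module.finrank ℝ (Eucl d))⁻¹| = ((2 * π) ^ d)⁻¹ := by
    rw [abs_of_pos (by positivity), finrank_euclideanSpace_fin]
  rw [e2] at hs
  rw [e1, Complex.ofReal_mul, mul_assoc, ← Complex.real_smul (x := ((2 * π) ^ d)⁻¹), ← hs,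
    ← integral_const_mul]
  congr 1 with η
  simp only [real_inner_smul_left, smul_eq_mul]
  push_cast
  ring

theorem quasiMeasurePreserving_const_smul {R : ℝ} (hR : R ≠ 0) :
    Measure.QuasiMeasurePreserving (fun x : Eucl d => R • x) volume volume := by
  refine ⟨by fun_prop, ?_⟩
  rw [Measure.map_addHaar_smul volume hR]
  exact Measure.smul_absolutelyContinuous

/-- A density in `L¹ ∩ L²` is the Fourier transform of its inverse Fourier
transform. -/
theorem HasDensity.fourierHat_ae_eq {Φ ψ : Eucl d → ℝ} (h : HasDensity Φ ψ)
    (h1 : Integrable ψ) (h2 : MemLp ψ 2) :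
    MemLp Φ 2 ∧ fourierHat Φ =ᵐ[volume] fun ω => (ψ ω : ℂ) := by
  set Ψ : Eucl d → ℂ :=
    fun η : Eucl d => (((2 * π) ^ ((d : ℝ) / 2) * ψ ((2 * π) • η) : ℝ) : ℂ) with hΨ
  have hpi : (2 * π : ℝ) ≠ 0 := by positivity
  have hΨ1 : Integrable Ψ :=
    (((integrable_comp_smul_iff volume ψ hpi).2 h1).const_mul _).ofReal
  have hΨ2 : MemLp Ψ 2 := by
    have : MemLp (fun η : Eucl d => ψ ((2 * π) • η)) 2 := by
      rw [memLp_two_iff_integrable_sq]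
      · exact (integrable_comp_smul_iff volume (fun x => ψ x ^ 2) hpi).2
          ((memLp_two_iff_integrable_sq h2.1).1 h2)
      · exact h2.1.comp_quasiMeasurePreserving (quasiMeasurePreserving_const_smul hpi)
    exact (this.const_mul _).ofReal
  have hΦ : (fun x => (Φ x : ℂ)) = 𝓕⁻ Ψ := 
    funext fun z => (h z).trans (unitary_integral_eq_fourierInv ψ z)
  have hae := fourierInv_toLp_ae_eq hΨ1 hΨ2
  have hmem : MemLp (fun x => (Φ x : ℂ)) 2 (volume : Measure (Eucl d)) := by
    rw [hΦ]; exact (Lp.memLp _).ae_eq hae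
  have hlp : hmem.toLp (fun x => (Φ x : ℂ)) = 𝓕⁻ (hΨ2.toLp Ψ) := by
    refine Lp.ext ((hmem.coeFn_toLp).trans ?_)
    rw [hΦ]; exact hae.symm
  refine ⟨by simpa using hmem.re, ?_⟩
  have hinv : (𝓕 (hmem.toLp (fun x => (Φ x : ℂ))) : Lp ℂ 2 (volume : Measure (Eucl d)))
      = hΨ2.toLp Ψ := by rw [hlp, FourierTransform.fourier_fourierInv_eq]
  filter_upwards [(quasiMeasurePreserving_const_smul (inv_ne_zero hpi)).ae_eq hΨ2.coeFn_toLp]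
    with ω hω
  have hω' : (hΨ2.toLp Ψ) ((2 * π)⁻¹ • ω) = Ψ ((2 * π)⁻¹ • ω) := hω
  simp only [fourierHat, dif_pos hmem, hinv]
  rw [hω']
  simp only [hΨ, smul_inv_smul₀ hpi]
  rw [← Complex.ofReal_mul, ← mul_assoc, two_pi_rpow_mul, one_mul]

theorem aestronglyMeasurable_fourierHat (f : Eucl d → ℝ) :
    AEStronglyMeasurable (fourierHat f) volume := by
  by_cases hf : MemLp (fun x => (f x : ℂ)) 2 (volume : Measure (Eucl d))
  · have : fourierHat f = fun ω => (((2 * π) ^ (-(d : ℝ) / 2) : ℝ) : ℂ) *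
        (𝓕 (hf.toLp (fun x => (f x : ℂ))) : Lp ℂ 2 (volume : Measure (Eucl d)))
          ((2 * π)⁻¹ • ω) := by
      ext ω; simp only [fourierHat, dif_pos hf]
    rw [this]
    exact ((Lp.aestronglyMeasurable _).comp_quasiMeasurePreserving
      (quasiMeasurePreserving_const_smul (by positivity))).const_mul _
  · have : fourierHat f = fun _ => 0 := by
      ext ω; simp only [fourierHat, dif_neg hf]
    rw [this]
    exact aestronglyMeasurable_const

/-- Fourier inversion: a continuous function in `L²` whose Fourier transform is real and integrable
is the inverse Fourier transform of it. -/
theorem hasDensity_of_fourierHat {Φ : Eucl d → ℝ} (hc : Continuous Φ) (hΦ : MemLp Φ 2)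
    (hre : ∀ᵐ ω ∂(volume : Measure (Eucl d)), (fourierHat Φ ω).im = 0)
    (hint : Integrable (fun ω => (fourierHat Φ ω).re)) :
    HasDensity Φ (fun ω => (fourierHat Φ ω).re) := by
  have hmem : MemLp (fun x => (Φ x : ℂ)) 2 (volume : Measure (Eucl d)) := hΦ.ofReal
  have hpi : (2 * π : ℝ) ≠ 0 := by positivity
  set G : Lp ℂ 2 (volume : Measure (Eucl d)) := 𝓕 (hmem.toLp (fun x => (Φ x : ℂ))) with hG
  have hhat : ∀ ω, fourierHat Φ ω = (((2 * π) ^ (-(d : ℝ) / 2) : ℝ) : ℂ) * G ((2 * π)⁻¹ • ω) := by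
    intro ω; simp only [fourierHat, dif_pos hmem, hG]
  set Ψ : Eucl d → ℂ := fun η : Eucl d =>
    (((2 * π) ^ ((d : ℝ) / 2) * (fourierHat Φ ((2 * π) • η)).re : ℝ) : ℂ) with hΨ
  have hGΨ : G =ᵐ[volume] Ψ := by
    filter_upwards [(quasiMeasurePreserving_const_smul hpi).ae hre] with η hη
    have : ((fourierHat Φ ((2 * π) • η)).re : ℂ) = fourierHat Φ ((2 * π) • η) :=
      Complex.ext (by simp) (by simp [hη])
    simp only [hΨ]
    rw [Complex.ofReal_mul, this, hhat, inv_smul_smul₀ hpi, ← mul_assoc, ← Complex.ofReal_mul,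
      mul_comm ((2 * π) ^ ((d : ℝ) / 2)), two_pi_rpow_mul, Complex.ofReal_one, one_mul]
  have h2 : MemLp Ψ 2 := (Lp.memLp G).ae_eq hGΨ
  have h1 : Integrable Ψ :=
    (((integrable_comp_smul_iff volume (fun ω => (fourierHat Φ ω).re) hpi).2
      hint).const_mul _).ofReal
  have hlp : h2.toLp Ψ = G := Lp.ext (h2.coeFn_toLp.trans hGΨ.symm)
  have hae := fourierInv_toLp_ae_eq h1 h2
  rw [hlp, hG, FourierTransform.fourierInv_fourier_eq] at hae
  have heq : (fun x => (Φ x : ℂ)) = 𝓕⁻ Ψ :=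
    Continuous.ae_eq_iff_eq volume (Complex.continuous_ofReal.comp hc)
      (continuous_fourierInv h1) |>.1 (hmem.coeFn_toLp.symm.trans hae)
  exact fun z => (congrFun heq z).trans
    (unitary_integral_eq_fourierInv (fun ω => (fourierHat Φ ω).re) z).symm

/-! ### The power function on the Fourier side -/

/-- The Fourier transform of the functional `δ_x - ∑_{y ∈ X} a_y δ_y`, up to a factor of
modulus one. -/
noncomputable def symbol (X : Finset (Eucl d)) (x : Eucl d) (a : Eucl d → ℝ) (ω : Eucl d) : ℂ :=
  1 - ∑ y ∈ X, (a y : ℂ) * Complex.exp (inner ℝ ω (y - x) * Complex.I)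

theorem continuous_symbol (X : Finset (Eucl d)) (x : Eucl d) (a : Eucl d → ℝ) :
    Continuous (symbol X x a) := by
  unfold symbol
  fun_prop

theorem norm_symbol_le (X : Finset (Eucl d)) (x : Eucl d) (a : Eucl d → ℝ) (ω : Eucl d) :
    ‖symbol X x a ω‖ ≤ 1 + ∑ y ∈ X, |a y| := by
  refine (norm_sub_le _ _).trans ?_
  rw [norm_one]
  gcongr
  refine (norm_sum_le _ _).trans (Finset.sum_le_sum fun y _ => ?_)
  rw [norm_mul, Complex.norm_exp_ofReal_mul_I, mul_one, Complex.norm_real, Real.norm_eq_abs]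

theorem norm_symbol_sq (X : Finset (Eucl d)) (x : Eucl d) (a : Eucl d → ℝ) (ω : Eucl d) :
    ‖symbol X x a ω‖ ^ 2 = Real.cos (inner ℝ ω (x - x))
      - ∑ y ∈ X, a y * Real.cos (inner ℝ ω (x - y)) - ∑ y ∈ X, a y * Real.cos (inner ℝ ω (y - x))
      + ∑ y ∈ X, ∑ z ∈ X, a y * a z * Real.cos (inner ℝ ω (y - z)) := by
  have hre : (symbol X x a ω).re = 1 - ∑ y ∈ X, a y * Real.cos (inner ℝ ω (y - x)) := by
    simp [symbol, Complex.exp_ofReal_mul_I_re, Complex.re_sum]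
  have him : (symbol X x a ω).im = - ∑ y ∈ X, a y * Real.sin (inner ℝ ω (y - x)) := by
    simp [symbol, Complex.exp_ofReal_mul_I_im, Complex.im_sum]
  have h1 : ∀ y : Eucl d, Real.cos (inner ℝ ω (x - y)) = Real.cos (inner ℝ ω (y - x)) := by
    intro y; rw [← neg_sub, inner_neg_right, Real.cos_neg]
  have h2 : ∑ y ∈ X, ∑ z ∈ X, a y * a z * Real.cos (inner ℝ ω (y - z)) =
      (∑ y ∈ X, a y * Real.cos (inner ℝ ω (y - x))) ^ 2 +
      (∑ y ∈ X, a y * Real.sin (inner ℝ ω (y - x))) ^ 2 := by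
    rw [sq, sq, Finset.sum_mul_sum, Finset.sum_mul_sum, ← Finset.sum_add_distrib]
    refine Finset.sum_congr rfl fun y _ => ?_
    rw [← Finset.sum_add_distrib]
    refine Finset.sum_congr rfl fun z _ => ?_
    rw [show y - z = (y - x) - (z - x) by abel, inner_sub_right, Real.cos_sub]
    ring
  rw [Complex.sq_norm, Complex.normSq_apply, hre, him, h2, sub_self, inner_zero_right,
    Real.cos_zero]
  simp only [h1]
  ring

theorem HasDensity.eq_integral_cos {Φ ψ : Eucl d → ℝ} (h : HasDensity Φ ψ) (hψ : Integrable ψ)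
    (z : Eucl d) :
    Φ z = (2 * π) ^ (-(d : ℝ) / 2) * ∫ ω, ψ ω * Real.cos (inner ℝ ω z) := by
  have hi : Integrable (fun ω => Complex.exp (inner ℝ ω z * Complex.I) * (ψ ω : ℂ)) := by
    refine Integrable.bdd_mul (c := 1) hψ.ofReal (by fun_prop) (Filter.Eventually.of_forall ?_)
    intro ω; rw [Complex.norm_exp_ofReal_mul_I]
  have h' := congrArg Complex.re (h z)
  rw [Complex.ofReal_re, Complex.re_ofReal_mul] at h'
  rw [h']
  congr 1
  refine (integral_re hi).symm.trans ?_
  congr 1 with ω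
  rw [mul_comm]
  simp [Complex.exp_ofReal_mul_I_re]

theorem integrable_mul_cos {ψ : Eucl d → ℝ} (hψ : Integrable ψ) (z : Eucl d) :
    Integrable (fun ω => ψ ω * Real.cos (inner ℝ ω z)) := by
  refine Integrable.mul_bdd (c := 1) hψ (by fun_prop) (Filter.Eventually.of_forall fun ω => ?_)
  simpa using Real.abs_cos_le_one _

/-- The norm of `δ_x - ∑ a_y δ_y` is the norm of its symbol in the `L²` space with weight `ψ`. -/
theorem HasDensity.functionalNormSq_eq {Φ ψ : Eucl d → ℝ} (h : HasDensity Φ ψ)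
    (hψ : Integrable ψ) (X : Finset (Eucl d)) (x : Eucl d) (a : Eucl d → ℝ) :
    functionalNormSq Φ X x a =
      (2 * π) ^ (-(d : ℝ) / 2) * ∫ ω, ψ ω * ‖symbol X x a ω‖ ^ 2 := by
  have hc := integrable_mul_cos hψ
  have e : ∀ ω, ψ ω * ‖symbol X x a ω‖ ^ 2 = ψ ω * Real.cos (inner ℝ ω (x - x))
      - ∑ y ∈ X, a y * (ψ ω * Real.cos (inner ℝ ω (x - y)))
      - ∑ y ∈ X, a y * (ψ ω * Real.cos (inner ℝ ω (y - x)))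
      + ∑ y ∈ X, ∑ z ∈ X, a y * a z * (ψ ω * Real.cos (inner ℝ ω (y - z))) := by
    intro ω
    rw [norm_symbol_sq, mul_add, mul_sub, mul_sub, Finset.mul_sum, Finset.mul_sum, Finset.mul_sum]
    simp only [Finset.mul_sum]
    congr 1
    · congr 1
      · congr 1
        exact Finset.sum_congr rfl fun _ _ => by ring
      · exact Finset.sum_congr rfl fun _ _ => by ring
    · exact Finset.sum_congr rfl fun _ _ => Finset.sum_congr rfl fun _ _ => by ring
  have i1 : Integrable (fun ω => ∑ y ∈ X, a y * (ψ ω * Real.cos (inner ℝ ω (x - y)))) :=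
    integrable_finsetSum _ fun y _ => (hc _).const_mul _
  have i2 : Integrable (fun ω => ∑ y ∈ X, a y * (ψ ω * Real.cos (inner ℝ ω (y - x)))) :=
    integrable_finsetSum _ fun y _ => (hc _).const_mul _
  have i3 : Integrable (fun ω => ∑ y ∈ X, ∑ z ∈ X,
      a y * a z * (ψ ω * Real.cos (inner ℝ ω (y - z)))) :=
    integrable_finsetSum _ fun y _ => integrable_finsetSum _ fun z _ => (hc _).const_mul _
  have i4 : Integrable (fun ω => ψ ω * Real.cos (inner ℝ ω (x - x)) -
      ∑ y ∈ X, a y * (ψ ω * Real.cos (inner ℝ ω (x - y)))) := (hc _).sub i1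
  have i5 : Integrable (fun ω => ψ ω * Real.cos (inner ℝ ω (x - x)) -
      ∑ y ∈ X, a y * (ψ ω * Real.cos (inner ℝ ω (x - y))) -
      ∑ y ∈ X, a y * (ψ ω * Real.cos (inner ℝ ω (y - x)))) := i4.sub i2
  simp only [e]
  rw [integral_add i5 i3, integral_sub i4 i2,
    integral_sub (hc _) i1, integral_finsetSum _ fun y _ => (hc _).const_mul _,
    integral_finsetSum _ fun y _ => (hc _).const_mul _,
    integral_finsetSum _ fun y _ => integrable_finsetSum _ fun z _ => (hc _).const_mul _]
  simp only [functionalNormSq, h.eq_integral_cos hψ]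
  simp_rw [integral_finsetSum X fun z _ => (hc _).const_mul _, integral_const_mul]
  rw [mul_add, mul_sub, mul_sub, Finset.mul_sum, Finset.mul_sum, Finset.mul_sum]
  simp only [Finset.mul_sum]
  congr 1
  · congr 1
    · congr 1
      exact Finset.sum_congr rfl fun _ _ => by ring
    · exact Finset.sum_congr rfl fun _ _ => by ring
  · exact Finset.sum_congr rfl fun _ _ => Finset.sum_congr rfl fun _ _ => by ring

theorem integrable_mul_norm_symbol_sq {ψ : Eucl d → ℝ} (hψ : Integrable ψ)
    (X : Finset (Eucl d)) (x : Eucl d) (a : Eucl d → ℝ) :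
    Integrable (fun ω => ψ ω * ‖symbol X x a ω‖ ^ 2) := by
  refine Integrable.mul_bdd (c := (1 + ∑ y ∈ X, |a y|) ^ 2) hψ
    ((continuous_symbol X x a).norm.pow 2).aestronglyMeasurable
    (Filter.Eventually.of_forall fun ω => ?_)
  rw [norm_pow, norm_norm]
  gcongr
  exact norm_symbol_le _ _ _ _

theorem HasDensity.functionalNormSq_nonneg {Φ ψ : Eucl d → ℝ} (h : HasDensity Φ ψ)
    (hψ : Integrable ψ) (h0 : 0 ≤ᵐ[volume] ψ) (X : Finset (Eucl d)) (x : Eucl d)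
    (a : Eucl d → ℝ) : 0 ≤ functionalNormSq Φ X x a := by
  rw [h.functionalNormSq_eq hψ]
  refine mul_nonneg (by positivity) (integral_nonneg_of_ae ?_)
  filter_upwards [h0] with ω hω
  exact mul_nonneg hω (by positivity)

theorem powerFunction_sq_le {Φ : Eucl d → ℝ} {X : Finset (Eucl d)} {x : Eucl d}
    (h0 : ∀ a, 0 ≤ functionalNormSq Φ X x a) (a : Eucl d → ℝ) :
    powerFunction Φ X x ^ 2 ≤ functionalNormSq Φ X x a := by
  rw [powerFunction, Real.sq_sqrt (le_ciInf h0)]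
  exact ciInf_le ⟨0, by rintro _ ⟨b, rfl⟩; exact h0 b⟩ a

theorem le_powerFunction_sq {Φ : Eucl d → ℝ} {X : Finset (Eucl d)} {x : Eucl d} {B : ℝ}
    (hB : 0 ≤ B) (h : ∀ a, B ≤ functionalNormSq Φ X x a) :
    B ≤ powerFunction Φ X x ^ 2 := by
  rw [powerFunction, Real.sq_sqrt (hB.trans (le_ciInf h))]
  exact le_ciInf h

/-! ### Upper bounds for the power function from local polynomial reproduction -/

/-- Weights that reproduce polynomials of degree less than `ℓ` at `x` from points at distance at
most `ρ` make the symbol vanish at the origin to order `ℓ`. -/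
theorem norm_symbol_sq_le {X : Finset (Eucl d)} {x : Eucl d} {a : Eucl d → ℝ} {ℓ : ℕ} {L ρ : ℝ}
    (hℓ : 0 < ℓ) (hL : ∑ y ∈ X, |a y| ≤ L)
    (hloc : ∀ y ∈ X, a y ≠ 0 → ‖y - x‖ ≤ ρ)
    (hmom : ∀ ω : Eucl d, ∀ k < ℓ, ∑ y ∈ X, a y * inner ℝ ω (y - x) ^ k = if k = 0 then 1 else 0)
    (ω : Eucl d) :
    ‖symbol X x a ω‖ ^ 2 ≤ (1 + 3 * L) ^ 2 * min 1 ((ρ * ‖ω‖) ^ (2 * ℓ)) := by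
  have hL0 : 0 ≤ L := (Finset.sum_nonneg fun _ _ => abs_nonneg _).trans hL
  have hρ : 0 ≤ ρ := by
    by_contra hneg
    have hz : ∀ y ∈ X, a y = 0 := fun y hy => by
      by_contra h; exact hneg ((norm_nonneg _).trans (hloc y hy h))
    have := hmom 0 0 hℓ
    simp [Finset.sum_eq_zero hz] at this
  have hb : ‖symbol X x a ω‖ ≤ 1 + 3 * L := by
    refine (norm_symbol_le X x a ω).trans ?_
    linarith
  rcases le_total (ρ * ‖ω‖) 1 with hs | hs
  · have hs0 : 0 ≤ ρ * ‖ω‖ := by positivity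
    rw [min_eq_right (pow_le_one₀ hs0 hs), mul_comm 2 ℓ, pow_mul, ← mul_pow]
    refine pow_le_pow_left₀ (norm_nonneg _) ?_ 2
    have key : symbol X x a ω = ∑ y ∈ X, (a y : ℂ) *
        -(Complex.exp (inner ℝ ω (y - x) * Complex.I) -
          ∑ k ∈ Finset.range ℓ, ((inner ℝ ω (y - x) : ℂ) * Complex.I) ^ k / (k.factorial : ℂ)) := by
      have hT : ∑ y ∈ X, (a y : ℂ) *
          ∑ k ∈ Finset.range ℓ, ((inner ℝ ω (y - x) : ℂ) * Complex.I) ^ k / (k.factorial : ℂ)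
          = 1 := by
        simp only [Finset.mul_sum]
        rw [Finset.sum_comm, Finset.sum_eq_single_of_mem 0 (Finset.mem_range.2 hℓ)]
        · have := hmom ω 0 hℓ
          simp only [pow_zero, mul_one, if_true] at this
          simp only [pow_zero, Nat.factorial_zero, Nat.cast_one, div_one, mul_one]
          exact_mod_cast this
        · intro k hk hk0
          have := hmom ω k (Finset.mem_range.1 hk)
          rw [if_neg hk0] at this
          calc ∑ y ∈ X, (a y : ℂ) * (((inner ℝ ω (y - x) : ℂ) * Complex.I) ^ k / (k.factorial : ℂ))
              = ((∑ y ∈ X, a y * inner ℝ ω (y - x) ^ k : ℝ) : ℂ) *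
                (Complex.I ^ k / (k.factorial : ℂ)) := by
                push_cast
                rw [Finset.sum_mul]
                exact Finset.sum_congr rfl fun y _ => by rw [mul_pow]; ring
            _ = 0 := by rw [this]; simp
      simp only [neg_sub, mul_sub, Finset.sum_sub_distrib, hT]
      rfl
    rw [key]
    calc _ ≤ ∑ y ∈ X, |a y| * (3 * (ρ * ‖ω‖) ^ ℓ) := by
          refine (norm_sum_le _ _).trans (Finset.sum_le_sum fun y hy => ?_)
          rw [norm_mul, norm_neg, Complex.norm_real, Real.norm_eq_abs]
          by_cases hay : a y = 0
          · simp [hay]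
          refine mul_le_mul_of_nonneg_left ?_ (abs_nonneg _)
          have ht : ‖((inner ℝ ω (y - x) : ℂ) * Complex.I)‖ ≤ ρ * ‖ω‖ := by
            rw [norm_mul, Complex.norm_I, mul_one, Complex.norm_real]
            refine (norm_inner_le_norm _ _).trans ?_
            rw [mul_comm]
            exact mul_le_mul_of_nonneg_right (hloc y hy hay) (norm_nonneg _)
          refine (Complex.norm_exp_sub_sum_le_norm_mul_exp _ _).trans ?_
          rw [mul_comm]
          refine mul_le_mul ?_ (pow_le_pow_left₀ (norm_nonneg _) ht _) (by positivity) (by norm_num)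
          exact (Real.exp_le_exp.2 (ht.trans hs)).trans (Real.exp_one_lt_d9.le.trans (by norm_num))
      _ ≤ (1 + 3 * L) * (ρ * ‖ω‖) ^ ℓ := by
          rw [← Finset.sum_mul, ← mul_assoc]
          refine mul_le_mul_of_nonneg_right ?_ (by positivity)
          linarith
  · rw [min_eq_left (one_le_pow₀ hs), mul_one]
    exact pow_le_pow_left₀ (norm_nonneg _) hb 2

/-- The integrand of the upper bound for the power function is dominated by a dilation of the
integrable function `(1 + ‖ω‖)^{-β}`. -/
theorem rpow_neg_mul_min_le {β ρ t : ℝ} {ℓ : ℕ} (hβ : 0 < β) (hℓ : β ≤ 2 * ℓ) (hρ : 0 < ρ)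
    (ht : 0 ≤ t) :
    t ^ (-β) * min 1 ((ρ * t) ^ (2 * ℓ)) ≤ (2 * ρ) ^ β * (1 + ρ * t) ^ (-β) := by
  rcases ht.eq_or_lt with rfl | ht
  · rw [Real.zero_rpow (by linarith), zero_mul]; positivity
  set s := ρ * t with hs
  have hs0 : 0 < s := by positivity
  have e : t ^ (-β) = ρ ^ β * s ^ (-β) := by
    rw [hs, Real.mul_rpow hρ.le ht.le, ← mul_assoc, ← Real.rpow_add hρ]; simp
  have hd : (2 : ℝ) ^ β * (1 + s) ^ (-β) = ((1 + s) / 2) ^ (-β) := by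
    rw [Real.div_rpow (by positivity) (by positivity), Real.rpow_neg (x := 2) (by norm_num)]
    field_simp
  rw [e, Real.mul_rpow (by norm_num) hρ.le, mul_assoc, mul_comm ((2 : ℝ) ^ β), mul_assoc, hd]
  refine mul_le_mul_of_nonneg_left ?_ (by positivity)
  rcases le_total s 1 with h1 | h1
  · calc _ ≤ s ^ (-β) * s ^ (2 * ℓ) := by gcongr; exact min_le_right _ _
      _ = s ^ (2 * ℓ - β) := by
        rw [← Real.rpow_natCast, ← Real.rpow_add hs0]; congr 1; push_cast; ring
      _ ≤ 1 := Real.rpow_le_one hs0.le h1 (by linarith)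
      _ ≤ _ := Real.one_le_rpow_of_pos_of_le_one_of_nonpos (by positivity) (by linarith)
          (by linarith)
  · calc _ ≤ s ^ (-β) * 1 := by gcongr; exact min_le_left _ _
      _ = s ^ (-β) := mul_one _
      _ ≤ _ := Real.rpow_le_rpow_of_nonpos (by positivity) (by linarith) (by linarith)

/-- Locally reproducing weights on the scale `ρ` give a functional of squared norm
`O(ρ^{β-d})`. -/
theorem HasDensity.functionalNormSq_le {Φ ψ : Eucl d → ℝ} (h : HasDensity Φ ψ)
    (hψ : Integrable ψ) {A β : ℝ} (hβ : (d : ℝ) < β) (hA : 0 ≤ A)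
    (hle : ∀ᵐ ω, ψ ω ≤ A * ‖ω‖ ^ (-β))
    {X : Finset (Eucl d)} {x : Eucl d} {a : Eucl d → ℝ} {ℓ : ℕ} {L ρ : ℝ} (hρ : 0 < ρ)
    (hℓ : β ≤ 2 * ℓ) (hL : ∑ y ∈ X, |a y| ≤ L)
    (hloc : ∀ y ∈ X, a y ≠ 0 → ‖y - x‖ ≤ ρ)
    (hmom : ∀ ω : Eucl d, ∀ k < ℓ, ∑ y ∈ X, a y * inner ℝ ω (y - x) ^ k = if k = 0 then 1 else 0) :
    functionalNormSq Φ X x a ≤ A * (((2 * π) ^ (-(d : ℝ) / 2) * (1 + 3 * L) ^ 2 * 2 ^ β *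
      ∫ ω : Eucl d, (1 + ‖ω‖) ^ (-β)) * ρ ^ (β - d)) := by
  have hβ0 : 0 < β := lt_of_le_of_lt (Nat.cast_nonneg d) hβ
  have hℓ0 : 0 < ℓ := by
    rcases Nat.eq_zero_or_pos ℓ with h | h
    · subst h; simp at hℓ; linarith
    · exact h
  have hJ : Integrable (fun ω : Eucl d => (1 + ‖ω‖) ^ (-β)) :=
    integrable_one_add_norm (by simpa using hβ)
  have hJρ : Integrable (fun ω : Eucl d => (1 + ‖ρ • ω‖) ^ (-β)) :=
    (integrable_comp_smul_iff volume (fun ω : Eucl d => (1 + ‖ω‖) ^ (-β)) hρ.ne').2 hJ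
  have hscale : ∫ ω : Eucl d, (1 + ‖ρ • ω‖) ^ (-β) =
      ρ ^ (-(d : ℝ)) * ∫ ω : Eucl d, (1 + ‖ω‖) ^ (-β) := by
    rw [Measure.integral_comp_smul volume (fun ω : Eucl d => (1 + ‖ω‖) ^ (-β)) ρ,
      finrank_euclideanSpace_fin, abs_of_pos (by positivity), smul_eq_mul,
      Real.rpow_neg hρ.le, Real.rpow_natCast]
  rw [h.functionalNormSq_eq hψ]
  calc _ ≤ (2 * π) ^ (-(d : ℝ) / 2) * ∫ ω : Eucl d,
        (A * (1 + 3 * L) ^ 2 * (2 * ρ) ^ β) * (1 + ‖ρ • ω‖) ^ (-β) := by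
        refine mul_le_mul_of_nonneg_left ?_ (by positivity)
        refine integral_mono_ae (integrable_mul_norm_symbol_sq hψ X x a) (hJρ.const_mul _) ?_
        filter_upwards [hle] with ω hω
        have h1 := norm_symbol_sq_le hℓ0 hL hloc hmom ω
        have h2 := rpow_neg_mul_min_le hβ0 hℓ hρ (norm_nonneg ω)
        have hn : ‖ρ • ω‖ = ρ * ‖ω‖ := by rw [norm_smul, Real.norm_eq_abs, abs_of_pos hρ]
        calc ψ ω * ‖symbol X x a ω‖ ^ 2 ≤ (A * ‖ω‖ ^ (-β)) * ‖symbol X x a ω‖ ^ 2 := by gcongr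
          _ ≤ (A * ‖ω‖ ^ (-β)) * ((1 + 3 * L) ^ 2 * min 1 ((ρ * ‖ω‖) ^ (2 * ℓ))) := by gcongr
          _ = (A * (1 + 3 * L) ^ 2) * (‖ω‖ ^ (-β) * min 1 ((ρ * ‖ω‖) ^ (2 * ℓ))) := by ring
          _ ≤ (A * (1 + 3 * L) ^ 2) * ((2 * ρ) ^ β * (1 + ρ * ‖ω‖) ^ (-β)) := by gcongr
          _ = _ := by rw [hn]; ring
    _ = _ := by
        rw [integral_const_mul, hscale, Real.mul_rpow (by norm_num) hρ.le, sub_eq_add_neg,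
          Real.rpow_add hρ]
        ring

/-! ### Lower bounds for the power function from bump functions -/

/-- There is a smooth function supported in the unit ball with value `1` at the origin, given by an
inverse Fourier integral with a rapidly decaying `g`. -/
theorem exists_bump_fourier (d : ℕ) : ∃ g : 𝓢(Eucl d, ℂ),
    (∫ ξ, Complex.exp (inner ℝ ((2 * π) • ξ) (0 : Eucl d) * Complex.I) * g ξ = 1) ∧
    ∀ v : Eucl d, 1 ≤ ‖v‖ → ∫ ξ, Complex.exp (inner ℝ ((2 * π) • ξ) v * Complex.I) * g ξ = 0 := by
  let b : ContDiffBump (0 : Eucl d) := ⟨1 / 2, 1, by norm_num, by norm_num⟩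
  have hc : HasCompactSupport (fun x => (b x : ℂ)) :=
    b.hasCompactSupport.comp_left (g := fun t : ℝ => (t : ℂ)) Complex.ofReal_zero
  have hs : ContDiff ℝ (⊤ : ℕ∞) (fun x => (b x : ℂ)) := Complex.ofRealCLM.contDiff.comp b.contDiff
  let B : 𝓢(Eucl d, ℂ) := hc.toSchwartzMap hs
  have hB : ∀ v, ∫ ξ, Complex.exp (inner ℝ ((2 * π) • ξ) v * Complex.I) * (𝓕 B) ξ = (b v : ℂ) := by
    intro v
    have h1 : 𝓕⁻ (𝓕 B) v = B v := by rw [FourierTransform.fourierInv_fourier_eq]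
    rw [SchwartzMap.fourierInv_coe, Real.fourierInv_eq'] at h1
    simpa [real_inner_smul_left, B] using h1
  refine ⟨𝓕 B, ?_, fun v hv => ?_⟩
  · rw [hB, b.one_of_mem_closedBall (by simp [b]), Complex.ofReal_one]
  · rw [hB, b.zero_of_le_dist (by simpa [b] using hv), Complex.ofReal_zero]

theorem integrable_schwartz_sq_mul (g : 𝓢(Eucl d, ℂ)) (R c : ℝ) (hc : 0 ≤ c) (m : ℕ) :
    Integrable (fun ξ => ‖g ξ‖ ^ 2 * (R ^ 2 + c * ‖ξ‖ ^ 2) ^ m) := by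
  obtain ⟨C, hC⟩ := g.decay 0 0
  have hb : ∀ ξ, ‖g ξ‖ ≤ C := fun ξ => by simpa using hC.2 ξ
  have hC0 : 0 ≤ C := (norm_nonneg _).trans (hb 0)
  have i1 : Integrable (fun ξ => C * (2 ^ (m - 1) * (R ^ 2) ^ m * ‖g ξ‖ +
      2 ^ (m - 1) * c ^ m * (‖ξ‖ ^ (2 * m) * ‖g ξ‖))) :=
    (((g.integrable.norm).const_mul _).add ((g.integrable_pow_mul volume (2 * m)).const_mul _)
      ).const_mul _
  have hcont : Continuous (fun ξ => ‖g ξ‖ ^ 2 * (R ^ 2 + c * ‖ξ‖ ^ 2) ^ m) := by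
    have := g.continuous
    fun_prop
  refine i1.mono' hcont.aestronglyMeasurable (Filter.Eventually.of_forall fun ξ => ?_)
  rw [Real.norm_eq_abs, abs_of_nonneg (by positivity)]
  have h1 := add_pow_le (sq_nonneg R) (mul_nonneg hc (sq_nonneg ‖ξ‖)) m
  calc ‖g ξ‖ ^ 2 * (R ^ 2 + c * ‖ξ‖ ^ 2) ^ m
      ≤ (C * ‖g ξ‖) * (2 ^ (m - 1) * ((R ^ 2) ^ m + (c * ‖ξ‖ ^ 2) ^ m)) := by
        rw [sq ‖g ξ‖]
        gcongr
        exact hb ξ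
    _ = _ := by rw [mul_pow c, ← pow_mul ‖ξ‖]; ring

/-- If the density of `Φ` decays at most like `‖ω‖^{-2m}`, then testing the functional
`δ_x - ∑ a_y δ_y` on a bump function that is supported in the ball of radius `q` around `x`, where
`q` is at most the distance of `x` to `X`, bounds its norm from below. -/
theorem exists_le_functionalNormSq (d m : ℕ) {R : ℝ} (hR : 0 < R) : ∃ c : ℝ, 0 < c ∧
    ∀ (Φ ψ : Eucl d → ℝ), HasDensity Φ ψ → Integrable ψ → ∀ T : ℝ, 0 < T →
      (∀ᵐ ω, T * ((1 + ‖ω‖ ^ 2) ^ m)⁻¹ ≤ ψ ω) →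
      ∀ (X : Finset (Eucl d)) (x : Eucl d) (a : Eucl d → ℝ) (q : ℝ), 0 < q → q ≤ R →
        (∀ y ∈ X, q ≤ ‖y - x‖) →
        c * T * q ^ (2 * (m : ℝ) - d) ≤ functionalNormSq Φ X x a := by
  obtain ⟨g, hg0, hg1⟩ := exists_bump_fourier d
  set c₁ : ℝ := (2 * π) ^ 2 with hc₁
  set w : Eucl d → ℝ := fun ξ => (R ^ 2 + c₁ * ‖ξ‖ ^ 2) ^ m with hw
  have hw0 : ∀ ξ, 0 < w ξ := fun ξ => by simp only [hw]; positivity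
  have hwc : Continuous w := by fun_prop
  have hA := integrable_schwartz_sq_mul g R c₁ (by positivity) m
  set A : ℝ := (∫ ξ, ‖g ξ‖ ^ 2 * w ξ) + 1 with hAdef
  have hA1 : 0 < A := by
    have : 0 ≤ ∫ ξ, ‖g ξ‖ ^ 2 * w ξ :=
      integral_nonneg fun ξ => mul_nonneg (sq_nonneg _) (hw0 ξ).le
    linarith
  refine ⟨(2 * π) ^ (-(d : ℝ) / 2) * (2 * π) ^ d * A⁻¹, by positivity, ?_⟩
  intro Φ ψ h hψ T hT hle X x a q hq hqR hX
  set E : Eucl d → ℂ := fun ξ => symbol X x a ((2 * π / q) • ξ) with hE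
  have hEc : Continuous E := (continuous_symbol X x a).comp (continuous_const_smul _)
  have hq2 : (2 * π / q) ≠ 0 := by positivity
  -- the functional takes the value one on the bump function
  have hone : ∫ ξ, E ξ * g ξ = 1 := by
    have hint : ∀ v : Eucl d,
        Integrable (fun ξ => Complex.exp (inner ℝ ((2 * π) • ξ) v * Complex.I) * g ξ) := fun v =>
      Integrable.bdd_mul (c := 1) g.integrable (by fun_prop)
        (Filter.Eventually.of_forall fun ξ => by rw [Complex.norm_exp_ofReal_mul_I])
    have e : ∀ ξ, E ξ * g ξ =
        Complex.exp (inner ℝ ((2 * π) • ξ) (0 : Eucl d) * Complex.I) * g ξ -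
        ∑ y ∈ X, (a y : ℂ) *
          (Complex.exp (inner ℝ ((2 * π) • ξ) (q⁻¹ • (y - x)) * Complex.I) * g ξ) := by
      intro ξ
      simp only [hE, symbol, inner_zero_right, Complex.ofReal_zero, zero_mul, Complex.exp_zero,
        sub_mul, Finset.sum_mul]
      congr 1
      refine Finset.sum_congr rfl fun y _ => ?_
      rw [mul_assoc, real_inner_smul_left, real_inner_smul_right, real_inner_smul_left]
      congr 5
      ring
    simp only [e]
    rw [integral_sub (hint 0) (integrable_finsetSum _ fun y _ => (hint _).const_mul _), hg0,
      integral_finsetSum _ fun y _ => (hint _).const_mul _]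
    rw [Finset.sum_eq_zero, sub_zero]
    intro y hy
    rw [integral_const_mul, hg1, mul_zero]
    rw [norm_smul, Real.norm_eq_abs, abs_of_pos (by positivity), inv_mul_eq_div, le_div_iff₀ hq,
      one_mul]
    exact hX y hy
  -- the density on the scale of the bump function
  have hψq : Integrable (fun ξ => ψ ((2 * π / q) • ξ)) :=
    (integrable_comp_smul_iff volume ψ hq2).2 hψ
  have hlow : ∀ᵐ ξ, T * q ^ (2 * m) * (w ξ)⁻¹ ≤ ψ ((2 * π / q) • ξ) := by
    filter_upwards [(quasiMeasurePreserving_const_smul hq2).ae hle] with ξ hξ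
    refine le_trans ?_ hξ
    rw [mul_assoc]
    refine mul_le_mul_of_nonneg_left ?_ hT.le
    rw [norm_smul, Real.norm_eq_abs, abs_of_pos (by positivity), ← div_eq_mul_inv,
      div_le_iff₀ (hw0 ξ), inv_mul_eq_div, le_div_iff₀ (by positivity), pow_mul, ← mul_pow]
    refine pow_le_pow_left₀ (by positivity) ?_ m
    have : q ^ 2 * (1 + (2 * π / q * ‖ξ‖) ^ 2) = q ^ 2 + c₁ * ‖ξ‖ ^ 2 := by
      rw [hc₁]; field_simp
    rw [this]
    gcongr
  have hbdd : ∀ ξ, ‖‖E ξ‖ ^ 2‖ ≤ (1 + ∑ y ∈ X, |a y|) ^ 2 := fun ξ => by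
    rw [norm_pow, norm_norm]
    exact pow_le_pow_left₀ (norm_nonneg _) (norm_symbol_le _ _ _ _) 2
  have hwi : Integrable (fun ξ => (w ξ)⁻¹) := by
    refine (hψq.const_mul (T * q ^ (2 * m))⁻¹).mono'
      (hwc.inv₀ fun ξ => (hw0 ξ).ne').aestronglyMeasurable ?_
    filter_upwards [hlow] with ξ hξ
    rw [Real.norm_eq_abs, abs_of_pos (inv_pos.2 (hw0 ξ)), inv_mul_eq_div,
      le_div_iff₀ (by positivity), mul_comm]
    exact hξ
  have hBi : Integrable (fun ξ => (w ξ)⁻¹ * ‖E ξ‖ ^ 2) :=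
    hwi.mul_bdd (c := (1 + ∑ y ∈ X, |a y|) ^ 2) (hEc.norm.pow 2).aestronglyMeasurable
      (Filter.Eventually.of_forall hbdd)
  have hEgi : Integrable (fun ξ => E ξ * g ξ) :=
    Integrable.bdd_mul (c := 1 + ∑ y ∈ X, |a y|) g.integrable hEc.aestronglyMeasurable
      (Filter.Eventually.of_forall fun ξ => norm_symbol_le _ _ _ _)
  -- Cauchy-Schwarz, in the form of the weighted arithmetic-geometric mean inequality
  have hB : A⁻¹ ≤ ∫ ξ, (w ξ)⁻¹ * ‖E ξ‖ ^ 2 := by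
    have h1 : (1 : ℝ) ≤ ∫ ξ, (A⁻¹ * (‖g ξ‖ ^ 2 * w ξ) + A * ((w ξ)⁻¹ * ‖E ξ‖ ^ 2)) / 2 := by
      calc (1 : ℝ) = ‖∫ ξ, E ξ * g ξ‖ := by rw [hone, norm_one]
        _ ≤ ∫ ξ, ‖E ξ * g ξ‖ := norm_integral_le_integral_norm _
        _ ≤ _ := by
          refine integral_mono hEgi.norm
            (((hA.const_mul A⁻¹).add (hBi.const_mul A)).div_const 2) fun ξ => ?_
          rw [norm_mul]
          have hpos := hw0 ξ
          have hid : (A⁻¹ * (‖g ξ‖ ^ 2 * w ξ) + A * ((w ξ)⁻¹ * ‖E ξ‖ ^ 2)) / 2 - ‖E ξ‖ * ‖g ξ‖ =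
              (A * w ξ)⁻¹ * (w ξ * ‖g ξ‖ - A * ‖E ξ‖) ^ 2 / 2 := by
            field_simp; ring
          have : 0 ≤ (A * w ξ)⁻¹ * (w ξ * ‖g ξ‖ - A * ‖E ξ‖) ^ 2 / 2 := by positivity
          show ‖E ξ‖ * ‖g ξ‖ ≤ (A⁻¹ * (‖g ξ‖ ^ 2 * w ξ) + A * ((w ξ)⁻¹ * ‖E ξ‖ ^ 2)) / 2
          linarith
    rw [integral_div, integral_add (hA.const_mul _) (hBi.const_mul _), integral_const_mul,
      integral_const_mul] at h1
    have h2 : A⁻¹ * (∫ ξ, ‖g ξ‖ ^ 2 * w ξ) ≤ 1 := by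
      rw [inv_mul_eq_div, div_le_one hA1, hAdef]; linarith
    have h3 : 1 ≤ A * ∫ ξ, (w ξ)⁻¹ * ‖E ξ‖ ^ 2 := by
      have h4 : A⁻¹ * (∫ ξ, ‖g ξ‖ ^ 2 * (R ^ 2 + c₁ * ‖ξ‖ ^ 2) ^ m) ≤ 1 := h2
      linarith
    rw [inv_le_iff_one_le_mul₀ hA1, mul_comm]
    exact h3
  have hscale := Measure.integral_comp_smul volume (fun ω => ψ ω * ‖symbol X x a ω‖ ^ 2) (2 * π / q)
  rw [finrank_euclideanSpace_fin, abs_of_pos (by positivity), smul_eq_mul] at hscale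
  have hscale' : ∫ ω, ψ ω * ‖symbol X x a ω‖ ^ 2 =
      (2 * π / q) ^ d * ∫ ξ, ψ ((2 * π / q) • ξ) * ‖E ξ‖ ^ 2 := by
    rw [hscale, ← mul_assoc, mul_inv_cancel₀ (by positivity), one_mul]
  have hmono : T * q ^ (2 * m) * A⁻¹ ≤ ∫ ξ, ψ ((2 * π / q) • ξ) * ‖E ξ‖ ^ 2 := by
    calc T * q ^ (2 * m) * A⁻¹ ≤ T * q ^ (2 * m) * ∫ ξ, (w ξ)⁻¹ * ‖E ξ‖ ^ 2 := by gcongr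
      _ = ∫ ξ, T * q ^ (2 * m) * ((w ξ)⁻¹ * ‖E ξ‖ ^ 2) := (integral_const_mul _ _).symm
      _ ≤ _ := by
        refine integral_mono_ae (hBi.const_mul _) (hψq.mul_bdd
          (c := (1 + ∑ y ∈ X, |a y|) ^ 2) (hEc.norm.pow 2).aestronglyMeasurable
          (Filter.Eventually.of_forall hbdd)) ?_
        filter_upwards [hlow] with ξ hξ
        rw [← mul_assoc]
        exact mul_le_mul_of_nonneg_right hξ (by positivity)
  rw [h.functionalNormSq_eq hψ, hscale']
  have hpow : q ^ (2 * (m : ℝ) - d) = q ^ (2 * m) / q ^ d := by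
    rw [Real.rpow_sub hq, ← Real.rpow_natCast, ← Real.rpow_natCast]; push_cast; rfl
  calc _ = (2 * π) ^ (-(d : ℝ) / 2) * ((2 * π / q) ^ d * (T * q ^ (2 * m) * A⁻¹)) := by
        rw [hpow, div_pow]; ring
    _ ≤ _ := by gcongr

/-! ### Local polynomial reproduction on domains with an interior cone condition -/

/-- The matrix of the monomials of coordinate degrees less than `ℓ`, evaluated at a family of points
that is indexed like these monomials. -/
def tensorVandermonde (ℓ : ℕ) (w : (Fin d → Fin ℓ) → Eucl d) :
    Matrix (Fin d → Fin ℓ) (Fin d → Fin ℓ) ℝ :=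
  Matrix.of fun α β => ∏ i, (w β i) ^ (α i : ℕ)

/-- The points of the integer grid `{0, …, ℓ-1}^d`. -/
def gridPoint (ℓ : ℕ) (β : Fin d → Fin ℓ) : Eucl d :=
  WithLp.toLp 2 fun i => ((β i : ℕ) : ℝ)

/-- On the grid, the matrix is a Kronecker power of a Vandermonde matrix. -/
theorem isUnit_det_tensorVandermonde_gridPoint (ℓ : ℕ) :
    IsUnit (tensorVandermonde (d := d) ℓ (gridPoint ℓ)).det := by
  set V : Matrix (Fin ℓ) (Fin ℓ) ℝ := (Matrix.vandermonde fun b : Fin ℓ => ((b : ℕ) : ℝ)).transpose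
    with hV
  have hVdet : IsUnit V.det := by
    rw [hV, Matrix.det_transpose, isUnit_iff_ne_zero, Matrix.det_vandermonde_ne_zero_iff]
    intro a b hab
    exact Fin.ext (Nat.cast_injective (R := ℝ) hab)
  set N : Matrix (Fin d → Fin ℓ) (Fin d → Fin ℓ) ℝ :=
    Matrix.of fun β α => ∏ i, V⁻¹ (β i) (α i) with hN
  refine Matrix.isUnit_det_of_right_inverse (B := N) ?_
  ext α α'
  have h1 : ∀ i, ∑ b, V (α i) b * V⁻¹ b (α' i) = if α i = α' i then 1 else 0 := fun i => by
    rw [← Matrix.mul_apply, Matrix.mul_nonsing_inv _ hVdet, Matrix.one_apply]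
  calc (tensorVandermonde (d := d) ℓ (gridPoint ℓ) * N : Matrix _ _ ℝ) α α'
      = ∑ β : Fin d → Fin ℓ, ∏ i, V (α i) (β i) * V⁻¹ (β i) (α' i) := by
        rw [Matrix.mul_apply]
        refine Finset.sum_congr rfl fun β _ => ?_
        rw [Finset.prod_mul_distrib]
        rfl
    _ = ∏ i, ∑ b, V (α i) b * V⁻¹ b (α' i) := by
        rw [Finset.prod_univ_sum]
        simp
    _ = (1 : Matrix _ _ ℝ) α α' := by
        simp only [h1, Matrix.one_apply]
        by_cases h : α = α'
        · simp [h]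
        · rw [if_neg h]
          obtain ⟨i, hi⟩ := Function.ne_iff.1 h
          exact Finset.prod_eq_zero (Finset.mem_univ i) (if_neg hi)

/-- Interpolation stays stable when the grid is perturbed slightly. -/
theorem exists_tensorVandermonde_inv_bound (d ℓ : ℕ) : ∃ δ A : ℝ, 0 < δ ∧ 0 ≤ A ∧
    ∀ w : (Fin d → Fin ℓ) → Eucl d, (∀ β, ‖w β - gridPoint ℓ β‖ ≤ δ) →
      IsUnit (tensorVandermonde ℓ w).det ∧ ∀ β α, |(tensorVandermonde ℓ w)⁻¹ β α| ≤ A := by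
  have hcont : Continuous (tensorVandermonde (d := d) ℓ) := by
    refine continuous_matrix fun α β => ?_
    simp only [tensorVandermonde, Matrix.of_apply]
    fun_prop
  have hdet : Continuous fun w => (tensorVandermonde (d := d) ℓ w).det := hcont.matrix_det
  have h0 := isUnit_det_tensorVandermonde_gridPoint (d := d) ℓ
  rw [isUnit_iff_ne_zero] at h0
  have hinv : ∀ β α, ContinuousAt (fun w => (tensorVandermonde (d := d) ℓ w)⁻¹ β α)
      (gridPoint ℓ) := by
    intro β α
    simp only [Matrix.inv_def, Ring.inverse_eq_inv', Matrix.smul_apply, smul_eq_mul]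
    exact (hdet.continuousAt.inv₀ h0).mul
      ((hcont.matrix_adjugate.matrix_elem β α).continuousAt)
  set A : ℝ := ∑ β, ∑ α, (|(tensorVandermonde (d := d) ℓ (gridPoint ℓ))⁻¹ β α| + 1) with hA
  -- `A` is a strict upper bound for all entries of the inverse on the unperturbed grid
  have hle : ∀ β α, |(tensorVandermonde (d := d) ℓ (gridPoint ℓ))⁻¹ β α| < A := by
    intro β α
    have h1 : |(tensorVandermonde (d := d) ℓ (gridPoint ℓ))⁻¹ β α| + 1 ≤
        ∑ α, (|(tensorVandermonde (d := d) ℓ (gridPoint ℓ))⁻¹ β α| + 1) :=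
      Finset.single_le_sum
        (f := fun α => |(tensorVandermonde (d := d) ℓ (gridPoint ℓ))⁻¹ β α| + 1)
        (fun _ _ => by positivity) (Finset.mem_univ α)
    have h2 : ∑ α, (|(tensorVandermonde (d := d) ℓ (gridPoint ℓ))⁻¹ β α| + 1) ≤ A :=
      Finset.single_le_sum
        (f := fun β => ∑ α, (|(tensorVandermonde (d := d) ℓ (gridPoint ℓ))⁻¹ β α| + 1))
        (fun _ _ => by positivity) (Finset.mem_univ β)
    linarith
  have hev : ∀ᶠ w in nhds (gridPoint (d := d) ℓ), (tensorVandermonde (d := d) ℓ w).det ≠ 0 ∧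
      ∀ β α, |(tensorVandermonde (d := d) ℓ w)⁻¹ β α| < A := by
    refine (hdet.continuousAt.eventually_ne h0).and ?_
    rw [Filter.eventually_all]
    intro β
    rw [Filter.eventually_all]
    intro α
    exact (hinv β α).abs.eventually_lt continuousAt_const (hle β α)
  obtain ⟨δ, hδ, hball⟩ := Metric.eventually_nhds_iff.1 hev
  refine ⟨δ / 2, A, by positivity, ?_, fun w hw => ?_⟩
  · rw [hA]; positivity
  · have : dist w (gridPoint ℓ) < δ := by
      refine lt_of_le_of_lt ((dist_pi_le_iff (by positivity)).2 fun β => ?_) (half_lt_self hδ)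
      rw [dist_eq_norm]
      exact hw β
    obtain ⟨h1, h2⟩ := hball this
    exact ⟨isUnit_iff_ne_zero.2 h1, fun β α => (h2 β α).le⟩

/-- Extrapolation from the points `w β`, which are close to a grid, to the point `-u`, with weights
that are bounded uniformly. -/
theorem exists_extrapolation_weights (d ℓ : ℕ) : ∃ δ : ℝ, 0 < δ ∧ ∀ τ : ℝ, ∃ L : ℝ,
    ∀ u : Eucl d, ‖u‖ ≤ τ → ∀ w : (Fin d → Fin ℓ) → Eucl d, (∀ β, ‖w β - gridPoint ℓ β‖ ≤ δ) →
      ∃ a : (Fin d → Fin ℓ) → ℝ, ∑ β, |a β| ≤ L ∧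
        ∀ ω : Eucl d, ∀ k < ℓ, ∑ β, a β * inner ℝ ω (u + w β) ^ k = if k = 0 then 1 else 0 := by
  obtain ⟨δ, A, hδ, hA, hM⟩ := exists_tensorVandermonde_inv_bound d ℓ
  refine ⟨δ, hδ, fun τ => ⟨∑ _β : Fin d → Fin ℓ, ∑ α : Fin d → Fin ℓ,
    A * ∏ i, (τ ^ (α i : ℕ)), fun u hu w hw => ?_⟩⟩
  obtain ⟨hdet, hinv⟩ := hM w hw
  set M := tensorVandermonde ℓ w with hMdef
  set b : (Fin d → Fin ℓ) → ℝ := fun α => ∏ i, (-u i) ^ (α i : ℕ) with hb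
  have hcoord : ∀ i, |u i| ≤ τ := fun i => by
    have := PiLp.norm_apply_le u i
    rw [Real.norm_eq_abs] at this
    exact this.trans hu
  have hrep : ∀ α, ∑ β, (M⁻¹.mulVec b) β * ∏ i, (w β i) ^ (α i : ℕ) = b α := by
    intro α
    have h1 : M.mulVec (M⁻¹.mulVec b) = b := by
      rw [Matrix.mulVec_mulVec, Matrix.mul_nonsing_inv _ hdet, Matrix.one_mulVec]
    have h2 := congrFun h1 α
    rw [← h2]
    simp only [Matrix.mulVec, dotProduct]
    exact Finset.sum_congr rfl fun β _ => mul_comm _ _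
  refine ⟨M⁻¹.mulVec b, ?_, fun ω k hk => ?_⟩
  · refine Finset.sum_le_sum fun β _ => ?_
    simp only [Matrix.mulVec, dotProduct]
    refine (Finset.abs_sum_le_sum_abs _ _).trans (Finset.sum_le_sum fun α _ => ?_)
    rw [abs_mul, hb, Finset.abs_prod]
    refine mul_le_mul (hinv β α) ?_ (by positivity) hA
    refine Finset.prod_le_prod (fun _ _ => abs_nonneg _) fun i _ => ?_
    rw [abs_pow, abs_neg]
    exact pow_le_pow_left₀ (abs_nonneg _) (hcoord i) _
  · -- `p(v) = ⟨ω, u + v⟩^k` is a combination of the reproduced monomials, and `p(-u) = 0^k`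
    set p : MvPolynomial (Fin d) ℝ :=
      (MvPolynomial.C (inner ℝ ω u) + ∑ i, MvPolynomial.C (ω i) * MvPolynomial.X i) ^ k with hp
    have hev : ∀ v : Eucl d, MvPolynomial.eval (fun i => v i) p = inner ℝ ω (u + v) ^ k := by
      intro v
      simp only [hp, map_pow, map_add, map_sum, map_mul, MvPolynomial.eval_C, MvPolynomial.eval_X,
        inner_add_right]
      congr 2
      simp [PiLp.inner_apply, mul_comm]
    have hdeg : p.totalDegree ≤ k := by
      refine (MvPolynomial.totalDegree_pow _ _).trans ?_
      refine (Nat.mul_le_mul_left k ?_).trans_eq (mul_one k)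
      refine (MvPolynomial.totalDegree_add _ _).trans (max_le (by simp) ?_)
      refine MvPolynomial.totalDegree_finsetSum_le fun i _ => ?_
      refine (MvPolynomial.totalDegree_mul _ _).trans ?_
      simp
    have hlin : ∑ β, (M⁻¹.mulVec b) β * MvPolynomial.eval (fun i => w β i) p =
        MvPolynomial.eval (fun i => (-u) i) p := by
      simp only [MvPolynomial.eval_eq', Finset.mul_sum]
      rw [Finset.sum_comm]
      refine Finset.sum_congr rfl fun e he => ?_
      have hlt : ∀ i, e i < ℓ := fun i =>
        ((MvPolynomial.monomial_le_degreeOf i he).trans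
          ((MvPolynomial.degreeOf_le_totalDegree p i).trans hdeg)).trans_lt hk
      have := hrep fun i => ⟨e i, hlt i⟩
      simp only [hb] at this
      simp only [PiLp.neg_apply]
      rw [← this, Finset.mul_sum]
      exact Finset.sum_congr rfl fun β _ => by ring
    simp only [hev] at hlin
    rw [hlin, add_neg_cancel, inner_zero_right, zero_pow_eq]

/-- A ball of radius `G` around `τ ξ` is contained in the cone with axis `ξ` and angle `θ` if `τ` is
large compared to `G`. -/
theorem mem_of_cone {Ω : Set (Eucl d)} {x ξ : Eucl d} {θ r G τ H : ℝ} (hξ : ‖ξ‖ = 1)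
    (hcone : ∀ y : Eucl d, ‖y‖ = 1 → cos θ ≤ inner ℝ y ξ → ∀ t : ℝ, 0 ≤ t → t ≤ r → x + t • y ∈ Ω)
    (hθ : 0 ≤ cos θ) (hG : G < τ) (hτ : cos θ * (τ + G) ≤ τ - G) (hH : 0 ≤ H)
    (hr : H * (τ + G) ≤ r) {v : Eucl d} (hv : ‖v‖ ≤ G) : x + H • (τ • ξ + v) ∈ Ω := by
  set p := τ • ξ + v with hp
  have hτ0 : 0 < τ := (norm_nonneg v).trans_lt (hv.trans_lt hG)
  have hnorm : ‖p‖ ≤ τ + G := by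
    refine (norm_add_le _ _).trans ?_
    rw [norm_smul, hξ, mul_one, Real.norm_eq_abs, abs_of_pos hτ0]
    linarith
  have hinner : τ - G ≤ inner ℝ p ξ := by
    rw [hp, inner_add_left, real_inner_smul_left, real_inner_self_eq_norm_sq, hξ]
    have h := abs_real_inner_le_norm v ξ
    rw [hξ, mul_one] at h
    linarith [(abs_le.1 (h.trans hv)).1]
  have hp0 : 0 < ‖p‖ := by
    have := real_inner_le_norm p ξ
    rw [hξ, mul_one] at this
    linarith
  have hmem := hcone (‖p‖⁻¹ • p) (by rw [norm_smul, norm_inv, norm_norm, inv_mul_cancel₀ hp0.ne'])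
    (by
      rw [real_inner_smul_left, inv_mul_eq_div, le_div_iff₀ hp0]
      calc cos θ * ‖p‖ ≤ cos θ * (τ + G) := by gcongr
        _ ≤ _ := hτ.trans hinner)
    (H * ‖p‖) (by positivity) ((mul_le_mul_of_nonneg_left hnorm hH).trans hr)
  rwa [smul_smul, mul_assoc, mul_inv_cancel₀ hp0.ne', mul_one] at hmem

theorem bddAbove_infDist {Ω : Set (Eucl d)} (hΩ : Bornology.IsBounded Ω) {X : Finset (Eucl d)}
    (hX : X.Nonempty) :
    BddAbove (Set.range fun y : Ω => Metric.infDist (y : Eucl d) (X : Set (Eucl d))) := by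
  obtain ⟨x₀, hx₀⟩ := hX
  obtain ⟨C, hC⟩ := hΩ.subset_closedBall x₀
  refine ⟨C, ?_⟩
  rintro _ ⟨y, rfl⟩
  exact (Metric.infDist_le_dist_of_mem (Finset.mem_coe.2 hx₀)).trans (hC y.2)

theorem infDist_le_fillDistance {Ω : Set (Eucl d)} (hΩ : Bornology.IsBounded Ω)
    {X : Finset (Eucl d)} (hX : X.Nonempty) {y : Eucl d} (hy : y ∈ Ω) :
    Metric.infDist y (X : Set (Eucl d)) ≤ fillDistance Ω X :=
  le_ciSup (bddAbove_infDist hΩ hX) (⟨y, hy⟩ : Ω)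

/-- A nonempty set with an interior cone condition is infinite, hence no finite set has fill
distance zero in it. -/
theorem fillDistance_pos {Ω : Set (Eucl d)} (hΩ : Bornology.IsBounded Ω) (hc : InteriorCone Ω)
    {X : Finset (Eucl d)} (hX : X.Nonempty) (hXΩ : (X : Set (Eucl d)) ⊆ Ω) :
    0 < fillDistance Ω X := by
  obtain ⟨θ, r, -, -, hr, hcone⟩ := hc
  obtain ⟨x, hx⟩ := hX
  obtain ⟨ξ, hξ, hξc⟩ := hcone x (hXΩ hx)
  have hinf : Ω.Infinite := by
    refine Set.Infinite.mono (s := (fun t : ℝ => x + t • ξ) '' Set.Icc 0 r) ?_ ?_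
    · rintro _ ⟨t, ht, rfl⟩
      exact hξc ξ hξ (by rw [real_inner_self_eq_norm_sq, hξ]; simpa using cos_le_one θ) t ht.1 ht.2
    · refine (Set.Icc_infinite hr).image fun s _ t _ hst => ?_
      have h1 : s • ξ = t • ξ := add_left_cancel hst
      exact smul_left_injective ℝ (norm_ne_zero_iff.1 (by rw [hξ]; norm_num)) h1
  obtain ⟨y, hy, hyX⟩ := hinf.exists_notMem_finset X
  refine lt_of_lt_of_le ?_ (infDist_le_fillDistance hΩ ⟨x, hx⟩ hy)
  exact (X.finite_toSet.isClosed.notMem_iff_infDist_pos ⟨x, hx⟩).1 (by simpa using hyX)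

/-- Local polynomial reproduction: at every point of `Ω` there are bounded weights on the points
of `X` at distance `O(h)` that reproduce all polynomials of degree less than `ℓ`. -/
theorem exists_local_reproduction {Ω : Set (Eucl d)} (hΩ : Bornology.IsBounded Ω)
    (hc : InteriorCone Ω) {ℓ : ℕ} : ∃ h₀ K L : ℝ, 0 < h₀ ∧ 0 < K ∧
      ∀ X : Finset (Eucl d), X.Nonempty → (X : Set (Eucl d)) ⊆ Ω → fillDistance Ω X ≤ h₀ →
        ∀ x ∈ Ω, ∃ a : Eucl d → ℝ, ∑ y ∈ X, |a y| ≤ L ∧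
          (∀ y ∈ X, a y ≠ 0 → ‖y - x‖ ≤ K * fillDistance Ω X) ∧
          ∀ ω : Eucl d, ∀ k < ℓ,
            ∑ y ∈ X, a y * inner ℝ ω (y - x) ^ k = if k = 0 then 1 else 0 := by
  classical
  obtain ⟨δ, hδ, hL⟩ := exists_extrapolation_weights d ℓ
  have hc' := hc
  obtain ⟨θ, r, hθ0, hθ, hr, hcone⟩ := hc
  have hcos0 : 0 < cos θ := cos_pos_of_mem_Ioo ⟨by linarith, hθ⟩
  have hcos1 : cos θ < 1 := by
    have := Real.cos_lt_cos_of_nonneg_of_le_pi_div_two le_rfl hθ.le hθ0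
    rwa [cos_zero] at this
  -- the grid has radius `G`, and `τ` is so large that its translate by `τ ξ` is in the cone
  set G : ℝ := 1 + ∑ β : Fin d → Fin ℓ, ‖gridPoint ℓ β‖ with hG
  have hG0 : 0 < G := by positivity
  have hgrid : ∀ β : Fin d → Fin ℓ, ‖gridPoint ℓ β‖ ≤ G := fun β => by
    have := Finset.single_le_sum (f := fun β : Fin d → Fin ℓ => ‖gridPoint ℓ β‖)
      (fun _ _ => norm_nonneg _) (Finset.mem_univ β)
    linarith
  set τ : ℝ := G * (1 + cos θ) / (1 - cos θ) with hτ
  have h1c : 0 < 1 - cos θ := by linarith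
  have hτG : G < τ := by
    rw [hτ, lt_div_iff₀ h1c]
    exact mul_lt_mul_of_pos_left (by linarith) hG0
  have hτc : cos θ * (τ + G) ≤ τ - G := by
    have : τ * (1 - cos θ) = G * (1 + cos θ) := by rw [hτ]; field_simp
    nlinarith
  have hτ0 : 0 < τ := hG0.trans hτG
  have hτG0 : 0 < τ + G := add_pos hτ0 hG0
  clear_value τ G
  obtain ⟨L, hL⟩ := hL τ
  refine ⟨δ * r / (τ + G), (τ + G) / δ + 1, L, by positivity, by positivity, ?_⟩
  intro X hX hXΩ hh x hx
  obtain ⟨ξ, hξ, hξc⟩ := hcone x hx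
  set h := fillDistance Ω X with hhdef
  have hpos : 0 < h := fillDistance_pos hΩ hc' hX hXΩ
  set H : ℝ := h / δ with hH
  have hH0 : 0 < H := by positivity
  have hHr : H * (τ + G) ≤ r := by
    have hh' := (le_div_iff₀ hτG0).1 hh
    rw [hH, div_mul_eq_mul_div, div_le_iff₀ hδ, mul_comm r]
    exact hh'
  have hz : ∀ β : Fin d → Fin ℓ, x + H • (τ • ξ + gridPoint ℓ β) ∈ Ω := fun β =>
    mem_of_cone hξ hξc hcos0.le hτG hτc hH0.le hHr (hgrid β)
  have hy : ∀ β : Fin d → Fin ℓ, ∃ y ∈ X, ‖y - (x + H • (τ • ξ + gridPoint ℓ β))‖ ≤ h := by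
    intro β
    obtain ⟨y, hyX, hyd⟩ := X.finite_toSet.isCompact.exists_infDist_eq_dist
      (Finset.coe_nonempty.2 hX) (x + H • (τ • ξ + gridPoint ℓ β))
    refine ⟨y, hyX, ?_⟩
    rw [← dist_eq_norm, dist_comm, ← hyd]
    exact infDist_le_fillDistance hΩ hX (hz β)
  choose y hyX hyd using hy
  set w : (Fin d → Fin ℓ) → Eucl d := fun β => H⁻¹ • (y β - x) - τ • ξ with hw
  have hyw : ∀ β, y β - x = H • (τ • ξ + w β) := fun β => by
    rw [hw]
    simp only [add_sub_cancel, smul_inv_smul₀ hH0.ne']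
  have hwδ : ∀ β, ‖w β - gridPoint ℓ β‖ ≤ δ := by
    intro β
    have e : w β - gridPoint ℓ β = H⁻¹ • (y β - (x + H • (τ • ξ + gridPoint ℓ β))) := by
      rw [← sub_sub, hyw, ← smul_sub, inv_smul_smul₀ hH0.ne']
      abel
    rw [e, norm_smul, norm_inv, Real.norm_eq_abs, abs_of_pos hH0, inv_mul_eq_div,
      div_le_iff₀ hH0]
    refine (hyd β).trans_eq ?_
    rw [hH]; field_simp
  obtain ⟨a, haL, ham⟩ := hL (τ • ξ)
    (by rw [norm_smul, hξ, mul_one, Real.norm_eq_abs, abs_of_pos hτ0]) w hwδ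
  -- different grid points may have the same nearest point of `X`; their weights are added
  refine ⟨fun z => ∑ β with y β = z, a β, ?_, ?_, ?_⟩
  · calc ∑ z ∈ X, |∑ β with y β = z, a β| ≤ ∑ z ∈ X, ∑ β with y β = z, |a β| :=
          Finset.sum_le_sum fun z _ => Finset.abs_sum_le_sum_abs _ _
      _ = ∑ β, |a β| := Finset.sum_fiberwise_of_maps_to (fun β _ => hyX β) _
      _ ≤ L := haL
  · intro z _ hz0
    obtain ⟨β, hβ, -⟩ := Finset.exists_ne_zero_of_sum_ne_zero hz0
    have hβz : y β = z := (Finset.mem_filter.1 hβ).2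
    rw [← hβz]
    have e : y β - x = (y β - (x + H • (τ • ξ + gridPoint ℓ β))) + H • (τ • ξ + gridPoint ℓ β) := by
      abel
    rw [e]
    refine (norm_add_le _ _).trans ?_
    have h1 : ‖H • (τ • ξ + gridPoint ℓ β)‖ ≤ H * (τ + G) := by
      rw [norm_smul, Real.norm_eq_abs, abs_of_pos hH0]
      refine mul_le_mul_of_nonneg_left ((norm_add_le _ _).trans ?_) hH0.le
      rw [norm_smul, hξ, mul_one, Real.norm_eq_abs, abs_of_pos hτ0]
      linarith [hgrid β]
    have h2 : H * (τ + G) = (τ + G) / δ * h := by rw [hH]; ring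
    linarith [hyd β]
  · intro ω k hk
    rw [← ham (H • ω) k hk]
    simp only [Finset.sum_mul]
    rw [← Finset.sum_fiberwise_of_maps_to (fun β _ => hyX β)
      (fun β => a β * inner ℝ (H • ω) (τ • ξ + w β) ^ k)]
    refine Finset.sum_congr rfl fun z _ => Finset.sum_congr rfl fun β hβ => ?_
    rw [← (Finset.mem_filter.1 hβ).2, hyw, real_inner_smul_left, real_inner_smul_right]

/-! ### The Fourier transform of the Whittle–Matérn kernel -/

/-- The factor `e^{-r²/(4t)}` is at most one, so the Gamma integrand is a majorant. -/
theorem integrable_besselIntegrand {ν : ℝ} (hν : 0 < ν) (r : ℝ) :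
    IntegrableOn (fun t => t ^ (ν - 1) * exp (-t - r ^ 2 / (4 * t))) (Set.Ioi 0) := by
  refine (Real.GammaIntegral_convergent hν).mono' ?_ ?_
  · refine ContinuousOn.aestronglyMeasurable (fun t ht => ?_) measurableSet_Ioi
    have ht0 : t ≠ 0 := (Set.mem_Ioi.1 ht).ne'
    refine ContinuousAt.continuousWithinAt (ContinuousAt.mul
      (Real.continuousAt_rpow_const t _ (Or.inl ht0)) ?_)
    have : 4 * t ≠ 0 := by positivity
    fun_prop (disch := assumption)
  · refine (ae_restrict_iff' measurableSet_Ioi).2 (Filter.Eventually.of_forall fun t ht => ?_)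
    have ht0 : 0 < t := ht
    rw [Real.norm_eq_abs, abs_of_nonneg (by positivity), mul_comm]
    gcongr
    have : 0 ≤ r ^ 2 / (4 * t) := by positivity
    linarith

/-- The integral representation of `K_ν` that comes from the substitution `t = (r / 2) e^u`. -/
theorem integral_rpow_mul_exp_eq_besselK {ν r : ℝ} (hν : 0 < ν) (hr : 0 < r) :
    ∫ t in Set.Ioi (0 : ℝ), t ^ (ν - 1) * exp (-t - r ^ 2 / (4 * t)) =
      2 * (r / 2) ^ ν * besselK ν r := by
  set f : ℝ → ℝ := fun t => t ^ (ν - 1) * exp (-t - r ^ 2 / (4 * t)) with hf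
  set φ : ℝ → ℝ := fun u => r / 2 * exp u with hφ
  have himage : φ '' Set.univ = Set.Ioi 0 := by
    ext t
    constructor
    · rintro ⟨u, -, rfl⟩
      simp only [hφ, Set.mem_Ioi]; positivity
    · intro ht
      have ht0 : 0 < t := ht
      refine ⟨log (t / (r / 2)), trivial, ?_⟩
      simp only [hφ]
      rw [exp_log (by positivity)]
      field_simp
  have hderiv : ∀ u ∈ Set.univ, HasDerivWithinAt φ (φ u) Set.univ u := fun u _ =>
    ((Real.hasDerivAt_exp u).const_mul (r / 2)).hasDerivWithinAt
  have hinj : Set.InjOn φ Set.univ := by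
    intro u _ v _ huv
    exact exp_injective (mul_left_cancel₀ (by positivity) huv)
  have hcomp : ∀ u, |φ u| • f (φ u) = (r / 2) ^ ν * (exp (ν * u) * exp (-(r * cosh u))) := by
    intro u
    have hφ0 : 0 < φ u := by simp only [hφ]; positivity
    have h1 : φ u * φ u ^ (ν - 1) = (r / 2) ^ ν * exp (ν * u) := by
      rw [Real.rpow_sub_one hφ0.ne', mul_div_cancel₀ _ hφ0.ne']
      simp only [hφ]
      rw [Real.mul_rpow (by positivity) (exp_pos u).le, ← Real.exp_mul, mul_comm u]
    have h2 : -φ u - r ^ 2 / (4 * φ u) = -(r * cosh u) := by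
      simp only [hφ, Real.cosh_eq, Real.exp_neg]
      field_simp
      ring
    rw [abs_of_pos hφ0, smul_eq_mul, hf]
    simp only []
    rw [h2, ← mul_assoc, h1, mul_assoc]
  have hint : Integrable (fun u => exp (ν * u) * exp (-(r * cosh u))) := by
    have h1 := (integrableOn_image_iff_integrableOn_abs_deriv_smul MeasurableSet.univ hderiv hinj
      f).1 (by rw [himage]; exact integrable_besselIntegrand hν r)
    simp only [hcomp, integrableOn_univ] at h1
    have h2 := h1.const_mul ((r / 2) ^ ν)⁻¹
    refine h2.congr (Filter.Eventually.of_forall fun u => ?_)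
    simp only []
    rw [← mul_assoc, inv_mul_cancel₀ (by positivity), one_mul]
  have hsym : ∫ u, exp (ν * u) * exp (-(r * cosh u)) =
      ∫ u, exp (-(r * cosh |u|)) * cosh (ν * |u|) := by
    have h1 : ∫ u, exp (-(ν * u)) * exp (-(r * cosh u)) =
        ∫ u, exp (ν * u) * exp (-(r * cosh u)) := by
      rw [← integral_neg_eq_self]
      simp
    have h2 : Integrable (fun u => exp (-(ν * u)) * exp (-(r * cosh u))) := by
      simpa using hint.comp_neg
    have h3 : ∀ u, exp (-(r * cosh |u|)) * cosh (ν * |u|) =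
        2⁻¹ * (exp (ν * u) * exp (-(r * cosh u)) + exp (-(ν * u)) * exp (-(r * cosh u))) := by
      intro u
      have : cosh (ν * |u|) = cosh (ν * u) := by
        rw [← Real.cosh_abs (ν * u), abs_mul, abs_of_pos hν]
      rw [Real.cosh_abs, this, Real.cosh_eq (ν * u)]
      ring
    simp only [h3]
    rw [integral_const_mul, integral_add hint h2, h1]
    ring
  rw [← himage, integral_image_eq_integral_abs_deriv_smul MeasurableSet.univ hderiv hinj f]
  simp only [hcomp, setIntegral_univ]
  rw [integral_const_mul, hsym,
    integral_comp_abs (f := fun u => exp (-(r * cosh u)) * cosh (ν * u)), besselK]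
  ring

/-- The density of the Whittle–Matérn kernel of `W_2^m(ℝ^d)`. -/
noncomputable def maternDensity (d m : ℕ) (ω : Eucl d) : ℝ := ((1 + ‖ω‖ ^ 2) ^ m)⁻¹

theorem maternDensity_pos (m : ℕ) (ω : Eucl d) : 0 < maternDensity d m ω := by
  unfold maternDensity; positivity

theorem maternDensity_le_one (m : ℕ) (ω : Eucl d) : maternDensity d m ω ≤ 1 :=
  inv_le_one_of_one_le₀ (one_le_pow₀ (by nlinarith [sq_nonneg ‖ω‖]))

theorem integrable_maternDensity {m : ℕ} (hm : (d : ℝ) / 2 < m) :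
    Integrable (maternDensity d m) := by
  have h := integrable_rpow_neg_one_add_norm_sq (E := Eucl d) (μ := volume) (r := 2 * m)
    (by rw [finrank_euclideanSpace_fin]; linarith)
  refine h.congr (Filter.Eventually.of_forall fun ω => ?_)
  simp only [maternDensity]
  rw [← Real.rpow_natCast (1 + ‖ω‖ ^ 2), ← Real.rpow_neg (by positivity)]
  congr 1
  ring

/-- With `Γ(m) (1 + ‖ω‖²)^{-m} = ∫_0^∞ t^{m-1} e^{-t(1 + ‖ω‖²)} dt` and Fubini's theorem, this
follows from the Fourier transform of the Gaussians `e^{-t‖ω‖²}` and the representation of `K_ν` as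
an integral over `t`. -/
theorem hasDensity_maternKernel {m : ℕ} (hm : (d : ℝ) / 2 < m) :
    HasDensity (maternKernel d m) (maternDensity d m) := by
  intro z
  have hm0 : (0 : ℝ) < m := lt_of_le_of_lt (by positivity) hm
  have hν : 0 < (m : ℝ) - d / 2 := by linarith
  have hΓ : 0 < Gamma (m : ℝ) := Real.Gamma_pos_of_pos hm0
  set F : Eucl d → ℝ → ℂ := fun ω t => Complex.exp (inner ℝ ω z * Complex.I) *
    ((t ^ ((m : ℝ) - 1) * exp (-((1 + ‖ω‖ ^ 2) * t)) : ℝ) : ℂ) with hF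
  have hreal : ∀ ω : Eucl d, ∫ t in Set.Ioi (0 : ℝ), t ^ ((m : ℝ) - 1) * exp (-((1 + ‖ω‖ ^ 2) * t))
      = Gamma m * maternDensity d m ω := by
    intro ω
    rw [Real.integral_rpow_mul_exp_neg_mul_Ioi hm0 (by positivity), maternDensity, mul_comm,
      one_div, Real.inv_rpow (by positivity), Real.rpow_natCast]
  have hreali : ∀ ω : Eucl d,
      IntegrableOn (fun t : ℝ => t ^ ((m : ℝ) - 1) * exp (-((1 + ‖ω‖ ^ 2) * t))) (Set.Ioi 0) := by
    intro ω
    by_contra hn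
    have h := hreal ω
    rw [integral_undef hn] at h
    exact (mul_pos hΓ (maternDensity_pos m ω)).ne h
  have hFint : Integrable (Function.uncurry F)
      ((volume : Measure (Eucl d)).prod (volume.restrict (Set.Ioi (0 : ℝ)))) := by
    have hmeas : AEStronglyMeasurable (Function.uncurry F)
        ((volume : Measure (Eucl d)).prod (volume.restrict (Set.Ioi (0 : ℝ)))) := by
      refine Measurable.aestronglyMeasurable ?_
      simp only [hF]
      unfold Function.uncurry
      fun_prop
    refine (integrable_prod_iff hmeas).2 ⟨Filter.Eventually.of_forall fun ω => ?_, ?_⟩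
    · exact (Integrable.ofReal (𝕜 := ℂ) (hreali ω)).const_mul
        (Complex.exp (inner ℝ ω z * Complex.I))
    · refine ((integrable_maternDensity hm).const_mul (Gamma m)).congr
        (Filter.Eventually.of_forall fun ω => ?_)
      simp only []
      rw [← hreal ω]
      refine setIntegral_congr_fun measurableSet_Ioi fun t ht => ?_
      have ht0 : 0 < t := ht
      simp only [hF, Function.uncurry]
      rw [norm_mul, Complex.norm_exp_ofReal_mul_I, one_mul, Complex.norm_real, Real.norm_eq_abs,
        abs_of_nonneg (by positivity)]
  have hswap := integral_integral_swap hFint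
  have hleft : ∀ ω, ∫ t in Set.Ioi (0 : ℝ), F ω t =
      (Gamma m : ℂ) * (Complex.exp (inner ℝ ω z * Complex.I) * maternDensity d m ω) := by
    intro ω
    simp only [hF]
    rw [integral_const_mul, integral_complex_ofReal, hreal ω]
    push_cast
    ring
  have hright : ∀ t ∈ Set.Ioi (0 : ℝ), ∫ ω, F ω t =
      ((π ^ ((d : ℝ) / 2) *
        (t ^ ((m : ℝ) - d / 2 - 1) * exp (-t - ‖z‖ ^ 2 / (4 * t))) : ℝ) : ℂ) := by
    intro t ht
    have ht0 : 0 < t := ht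
    have hg := GaussianFourier.integral_cexp_neg_mul_sq_norm_add (V := Eucl d) (b := (t : ℂ))
      (by simpa using ht0) Complex.I z
    have e : ∀ ω : Eucl d, F ω t = ((t ^ ((m : ℝ) - 1) * exp (-t) : ℝ) : ℂ) *
        Complex.exp (-(t : ℂ) * (‖ω‖ : ℂ) ^ 2 + Complex.I * (inner ℝ z ω : ℝ)) := by
      intro ω
      simp only [hF]
      rw [real_inner_comm z ω]
      push_cast
      rw [mul_left_comm, mul_assoc, ← Complex.exp_add, ← Complex.exp_add]
      congr 2
      ring
    simp only [e]
    rw [integral_const_mul, hg, finrank_euclideanSpace_fin]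
    have h1 : ((π : ℂ) / (t : ℂ)) ^ ((d : ℂ) / 2) =
        ((π ^ ((d : ℝ) / 2) * t ^ (-((d : ℝ) / 2)) : ℝ) : ℂ) := by
      rw [Real.rpow_neg ht0.le, ← div_eq_mul_inv, ← Real.div_rpow pi_pos.le ht0.le,
        Complex.ofReal_cpow (by positivity)]
      push_cast
      rfl
    have h2 : Complex.exp (Complex.I ^ 2 * (‖z‖ : ℂ) ^ 2 / (4 * (t : ℂ))) =
        ((exp (-(‖z‖ ^ 2 / (4 * t))) : ℝ) : ℂ) := by
      push_cast
      congr 1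
      rw [Complex.I_sq]
      ring
    have h3 : t ^ ((m : ℝ) - d / 2 - 1) = t ^ ((m : ℝ) - 1) * t ^ (-((d : ℝ) / 2)) := by
      rw [← Real.rpow_add ht0]; congr 1; ring
    rw [h1, h2, h3, sub_eq_add_neg (-t), Real.exp_add]
    push_cast
    ring
  simp only [hleft] at hswap
  rw [setIntegral_congr_fun measurableSet_Ioi hright, integral_const_mul,
    integral_complex_ofReal, integral_const_mul] at hswap
  have hI : ∫ ω : Eucl d, Complex.exp (inner ℝ ω z * Complex.I) * (maternDensity d m ω : ℂ) =
      (((Gamma m)⁻¹ * (π ^ ((d : ℝ) / 2) * ∫ t in Set.Ioi (0 : ℝ),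
        t ^ ((m : ℝ) - d / 2 - 1) * exp (-t - ‖z‖ ^ 2 / (4 * t))) : ℝ) : ℂ) := by
    rw [Complex.ofReal_mul, ← hswap, ← mul_assoc, ← Complex.ofReal_mul,
      inv_mul_cancel₀ hΓ.ne', Complex.ofReal_one, one_mul]
  rw [hI, ← Complex.ofReal_mul]
  congr 1
  have hc : (2 * π : ℝ) ^ (-(d : ℝ) / 2) * π ^ ((d : ℝ) / 2) = 2 ^ (-(d : ℝ) / 2) := by
    rw [Real.mul_rpow (by norm_num) pi_pos.le, mul_assoc, ← Real.rpow_add pi_pos]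
    have : -(d : ℝ) / 2 + d / 2 = 0 := by ring
    rw [this, Real.rpow_zero, mul_one]
  have hc' : ∀ J : ℝ, (2 * π : ℝ) ^ (-(d : ℝ) / 2) * ((Gamma m)⁻¹ * (π ^ ((d : ℝ) / 2) * J)) =
      2 ^ (-(d : ℝ) / 2) * J / Gamma m := by
    intro J
    rw [← hc]
    ring
  rw [hc']
  by_cases hz : z = 0
  · have hG : ∫ t in Set.Ioi (0 : ℝ), t ^ ((m : ℝ) - d / 2 - 1) * exp (-t - ‖z‖ ^ 2 / (4 * t)) =
        Gamma ((m : ℝ) - d / 2) := by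
      rw [Real.Gamma_eq_integral hν]
      congr 1 with t
      rw [hz, norm_zero, mul_comm]
      simp
    rw [hG]
    simp only [maternKernel, if_pos hz]
  · have hr : 0 < ‖z‖ := norm_pos_iff.2 hz
    rw [integral_rpow_mul_exp_eq_besselK hν hr]
    simp only [maternKernel, if_neg hz]
    have hp : (2 : ℝ) ^ (1 - (m : ℝ)) = 2 ^ (-(d : ℝ) / 2) * (2 / 2 ^ ((m : ℝ) - d / 2)) := by
      rw [mul_div_assoc', ← Real.rpow_add_one (by norm_num), ← Real.rpow_sub (by norm_num)]
      congr 1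
      ring
    rw [hp, Real.div_rpow hr.le (by norm_num)]
    ring

/-! ### Native space norms of scaled kernels -/

/-- Mathlib's weight is `(1 + ‖ω / (2π)‖²)^m` in the present normalization, which is equivalent to
`(1 + ‖ω‖²)^m`. -/
theorem MemW2.integrable {m : ℕ} {f : Eucl d → ℝ} (hf : MemW2 m f) :
    Integrable (fun ω => ‖fourierHat f ω‖ ^ 2 * (1 + ‖ω‖ ^ 2) ^ m) := by
  obtain ⟨-, hmem, hsob⟩ := hf
  obtain ⟨u, hu⟩ := TemperedDistribution.memSobolev_iff_exists_smulLeftCLM_fourier.1 hsob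
  rw [Lp.fourier_toTemperedDistribution_eq] at hu
  set G : Lp ℂ 2 (volume : Measure (Eucl d)) := 𝓕 (hmem.toLp (fun x => (f x : ℂ))) with hG
  set w : Eucl d → ℂ := fun x => (((1 + ‖x‖ ^ 2) ^ ((m : ℝ) / 2) : ℝ) : ℂ) with hw
  have hwT : w.HasTemperateGrowth := by simp only [hw]; fun_prop
  have hwc : Continuous w := hwT.1.continuous
  have hae : (fun x => w x * G x) =ᵐ[volume] u := by
    refine ae_eq_of_integral_schwartz ?_ ((Lp.memLp u).locallyIntegrable (by norm_num)) fun g => ?_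
    · have hGl : LocallyIntegrable (G : Eucl d → ℂ) volume :=
        (Lp.memLp G).locallyIntegrable (by norm_num)
      exact locallyIntegrableOn_univ.1
        ((hGl.locallyIntegrableOn _).continuousOn_mul hwc.continuousOn isOpen_univ.isLocallyClosed)
    · have h := DFunLike.congr_fun hu g
      rw [TemperedDistribution.smulLeftCLM_apply_apply, Lp.toTemperedDistribution_apply,
        Lp.toTemperedDistribution_apply] at h
      rw [← h]
      congr 1 with x
      rw [SchwartzMap.smulLeftCLM_apply_apply hwT]
      simp only [smul_eq_mul]
      ring
  have hsq : Integrable (fun η => ‖w η * G η‖ ^ 2) :=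
    ((Lp.memLp u).integrable_norm_pow (by norm_num)).congr
      (hae.mono fun η hη => congrArg (fun z : ℂ => ‖z‖ ^ 2) hη.symm)
  have hpi : (2 * π : ℝ) ≠ 0 := by positivity
  have hsq' := (integrable_comp_smul_iff volume (fun η => ‖w η * G η‖ ^ 2) (inv_ne_zero hpi)).2 hsq
  refine (hsq'.const_mul (((2 * π) ^ (-(d : ℝ) / 2)) ^ 2 * ((2 * π) ^ 2) ^ m)).mono' ?_ ?_
  · exact ((aestronglyMeasurable_fourierHat f).norm.pow 2).mul
      (Continuous.aestronglyMeasurable (by fun_prop))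
  · refine Filter.Eventually.of_forall fun ω => ?_
    rw [Real.norm_eq_abs, abs_of_nonneg (by positivity)]
    have hw2 : ∀ η, ‖w η‖ ^ 2 = (1 + ‖η‖ ^ 2) ^ m := fun η => by
      simp only [hw]
      rw [Complex.norm_real, Real.norm_eq_abs, abs_of_nonneg (by positivity),
        ← Real.rpow_natCast _ 2, ← Real.rpow_mul (by positivity), ← Real.rpow_natCast _ m]
      congr 1
      push_cast
      ring
    have hhat : fourierHat f ω = (((2 * π) ^ (-(d : ℝ) / 2) : ℝ) : ℂ) * G ((2 * π)⁻¹ • ω) := by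
      simp only [fourierHat, dif_pos hmem, hG]
    rw [hhat, norm_mul, norm_mul, mul_pow ‖_‖, mul_pow ‖_‖, hw2, Complex.norm_real,
      Real.norm_eq_abs,
      abs_of_nonneg (by positivity), norm_smul, Real.norm_eq_abs, abs_of_pos (by positivity)]
    have h1 : (1 + ‖ω‖ ^ 2) ^ m ≤ ((2 * π) ^ 2) ^ m * (1 + ((2 * π)⁻¹ * ‖ω‖) ^ 2) ^ m := by
      rw [← mul_pow]
      refine pow_le_pow_left₀ (by positivity) ?_ m
      have h2 : (2 * π) ^ 2 * (1 + ((2 * π)⁻¹ * ‖ω‖) ^ 2) = (2 * π) ^ 2 + ‖ω‖ ^ 2 := by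
        field_simp
      rw [h2]
      nlinarith [pi_gt_three]
    calc _ ≤ ((2 * π) ^ (-(d : ℝ) / 2)) ^ 2 * ‖G ((2 * π)⁻¹ • ω)‖ ^ 2 *
          (((2 * π) ^ 2) ^ m * (1 + ((2 * π)⁻¹ * ‖ω‖) ^ 2) ^ m) := by gcongr
      _ = _ := by ring

theorem MemW2.memLp {m : ℕ} {f : Eucl d → ℝ} (hf : MemW2 m f) : MemLp f 2 := by
  obtain ⟨-, hmem, -⟩ := hf
  simpa using hmem.re

theorem MemW2.integrable_sobolevSeminorm {m : ℕ} {f : Eucl d → ℝ} (hf : MemW2 m f) {j : ℕ}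
    (hj : j ≤ m) : Integrable (fun ω => ‖fourierHat f ω‖ ^ 2 * ‖ω‖ ^ (2 * j)) := by
  refine hf.integrable.mono' (((aestronglyMeasurable_fourierHat f).norm.pow 2).mul
    (Continuous.aestronglyMeasurable (by fun_prop))) (Filter.Eventually.of_forall fun ω => ?_)
  rw [Real.norm_eq_abs, abs_of_nonneg (by positivity), pow_mul]
  refine mul_le_mul_of_nonneg_left ?_ (by positivity)
  calc (‖ω‖ ^ 2) ^ j ≤ (1 + ‖ω‖ ^ 2) ^ j := by gcongr; linarith
    _ ≤ (1 + ‖ω‖ ^ 2) ^ m := pow_le_pow_right₀ (by nlinarith [sq_nonneg ‖ω‖]) hj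

theorem HasDensity.scaled {Φ ψ : Eucl d → ℝ} (h : HasDensity Φ ψ) {ε : ℝ} (hε : 0 < ε) :
    HasDensity (RBFScaling.scaled ε Φ) (fun ω => (ε ^ d)⁻¹ * ψ (ε⁻¹ • ω)) := by
  intro z
  rw [RBFScaling.scaled, h (ε • z)]
  have hs := Measure.integral_comp_smul (volume : Measure (Eucl d))
    (fun ω => Complex.exp (inner ℝ ω z * Complex.I) * (((ε ^ d)⁻¹ * ψ (ε⁻¹ • ω) : ℝ) : ℂ)) ε
  rw [finrank_euclideanSpace_fin, abs_of_pos (by positivity)] at hs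
  congr 1
  rw [← inv_smul_smul₀ (inv_ne_zero (pow_ne_zero d hε.ne'))
    (∫ ω, Complex.exp (inner ℝ ω z * Complex.I) * (((ε ^ d)⁻¹ * ψ (ε⁻¹ • ω) : ℝ) : ℂ)), ← hs,
    inv_inv, ← integral_smul]
  congr 1 with ω
  have hε' : (ε : ℂ) ^ d ≠ 0 := pow_ne_zero d (Complex.ofReal_ne_zero.2 hε.ne')
  rw [inv_smul_smul₀ hε.ne', real_inner_smul_left, real_inner_smul_right, Complex.real_smul]
  push_cast
  field_simp

theorem integrable_scaled_density {ψ : Eucl d → ℝ} (hψ : Integrable ψ) {ε : ℝ} (hε : 0 < ε) :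
    Integrable (fun ω => (ε ^ d)⁻¹ * ψ (ε⁻¹ • ω)) :=
  ((integrable_comp_smul_iff volume ψ (inv_ne_zero hε.ne')).2 hψ).const_mul _

theorem memLp_two_scaled_density {ψ : Eucl d → ℝ} (hψ : MemLp ψ 2) {ε : ℝ} (hε : 0 < ε) :
    MemLp (fun ω => (ε ^ d)⁻¹ * ψ (ε⁻¹ • ω)) 2 := by
  refine MemLp.const_mul ?_ _
  refine (memLp_two_iff_integrable_sq (hψ.1.comp_quasiMeasurePreserving
    (quasiMeasurePreserving_const_smul (inv_ne_zero hε.ne')))).2 ?_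
  exact (integrable_comp_smul_iff volume (fun x => ψ x ^ 2) (inv_ne_zero hε.ne')).2
    ((memLp_two_iff_integrable_sq hψ.1).1 hψ)

theorem HasDensity.fourierHat_scaled_re {Φ ψ : Eucl d → ℝ} (h : HasDensity Φ ψ)
    (h1 : Integrable ψ) (h2 : MemLp ψ 2) {ε : ℝ} (hε : 0 < ε) :
    ∀ᵐ ω, (fourierHat (RBFScaling.scaled ε Φ) ω).re = (ε ^ d)⁻¹ * ψ (ε⁻¹ • ω) := by
  filter_upwards [((h.scaled hε).fourierHat_ae_eq (integrable_scaled_density h1 hε)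
    (memLp_two_scaled_density h2 hε)).2] with ω hω
  rw [hω, Complex.ofReal_re]

theorem memLp_two_of_integrable_of_bounded {ψ : Eucl d → ℝ} (h1 : Integrable ψ) {A : ℝ}
    (h : ∀ᵐ ω, |ψ ω| ≤ A) : MemLp ψ 2 := by
  refine (memLp_two_iff_integrable_sq h1.1).2 ?_
  simp only [sq]
  exact h1.mul_bdd h1.1 h

/-- Domination of the Fourier transforms of two kernels gives an embedding of the native spaces. -/
theorem MemNative.of_le {Φ Φ' f : Eucl d → ℝ} (hf : MemNative Φ f) {t : ℝ} (ht : 0 < t)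
    (hle : ∀ᵐ ω, 0 < (fourierHat Φ ω).re ∧ t * (fourierHat Φ ω).re ≤ (fourierHat Φ' ω).re) :
    MemNative Φ' f ∧ nativeNorm Φ' f ≤ √(t⁻¹) * nativeNorm Φ f := by
  obtain ⟨hc, hL, hi⟩ := hf
  have hpt : ∀ᵐ ω, 0 ≤ ‖fourierHat f ω‖ ^ 2 / (fourierHat Φ' ω).re ∧
      ‖fourierHat f ω‖ ^ 2 / (fourierHat Φ' ω).re ≤
        t⁻¹ * (‖fourierHat f ω‖ ^ 2 / (fourierHat Φ ω).re) := by
    filter_upwards [hle] with ω hω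
    have h1 : 0 < t * (fourierHat Φ ω).re := mul_pos ht hω.1
    have h2 := h1.trans_le hω.2
    refine ⟨by positivity, ?_⟩
    calc _ ≤ ‖fourierHat f ω‖ ^ 2 / (t * (fourierHat Φ ω).re) :=
          div_le_div_of_nonneg_left (sq_nonneg _) h1 hω.2
      _ = _ := by rw [div_mul_eq_div_div_swap, div_eq_inv_mul _ t]
  have hi' : Integrable (fun ω => ‖fourierHat f ω‖ ^ 2 / (fourierHat Φ' ω).re) := by
    refine (hi.const_mul t⁻¹).mono' (AEMeasurable.aestronglyMeasurable ?_) ?_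
    · exact ((aestronglyMeasurable_fourierHat f).norm.pow 2).aemeasurable.div
        (Complex.measurable_re.comp_aemeasurable (aestronglyMeasurable_fourierHat Φ').aemeasurable)
    · filter_upwards [hpt] with ω hω
      rw [Real.norm_eq_abs, abs_of_nonneg hω.1]
      exact hω.2
  refine ⟨⟨hc, hL, hi'⟩, ?_⟩
  rw [nativeNorm, nativeNorm, ← Real.sqrt_mul (by positivity)]
  refine Real.sqrt_le_sqrt ?_
  rw [mul_left_comm, ← integral_const_mul t⁻¹]
  have hκ : 0 ≤ (2 * π) ^ (-(d : ℝ) / 2) := by positivity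
  refine mul_le_mul_of_nonneg_left ?_ hκ
  exact integral_mono_ae hi' (hi.const_mul _) (hpt.mono fun ω hω => hω.2)

theorem nativeNorm_nonneg (Φ f : Eucl d → ℝ) : 0 ≤ nativeNorm Φ f := Real.sqrt_nonneg _

/-! ### Power functions of scaled kernels -/

/-- If `Φ̂(ω) = O(‖ω‖^{-β})`, then `P_{X,Φ_ε}(x)² = O((ε h)^{β-d})`, uniformly in `X`, `x` and
`ε`. -/
theorem exists_powerFunction_scaled_sq_le {Ω : Set (Eucl d)} (hd : 1 ≤ d)
    (hΩ : Bornology.IsBounded Ω) (hc : InteriorCone Ω) {Φ ψ : Eucl d → ℝ} (h : HasDensity Φ ψ)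
    (hψ : Integrable ψ) (h0 : 0 ≤ᵐ[volume] ψ) {A β : ℝ} (hβ : (d : ℝ) < β) (hA : 0 ≤ A)
    (hle : ∀ᵐ ω, ω ≠ 0 → ψ ω ≤ A * ‖ω‖ ^ (-β)) :
    ∃ h₀ D : ℝ, 0 < h₀ ∧ 0 < D ∧ ∀ X : Finset (Eucl d), X.Nonempty → (X : Set (Eucl d)) ⊆ Ω →
      fillDistance Ω X ≤ h₀ → ∀ ε : ℝ, 0 < ε → ∀ x ∈ Ω,
        powerFunction (scaled ε Φ) X x ^ 2 ≤ D * ε ^ (β - d) * fillDistance Ω X ^ (β - d) := by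
  have : Nontrivial (Eucl d) := by
    have : Nonempty (Fin d) := ⟨⟨0, hd⟩⟩
    infer_instance
  -- the degree is such that `β ≤ 2 ℓ`, which makes the integrand bounded at the origin
  obtain ⟨h₀, K, L, hh₀, hK, hrep⟩ := exists_local_reproduction hΩ hc (ℓ := ⌈β⌉₊)
  have hJ0 : 0 ≤ ∫ ω : Eucl d, (1 + ‖ω‖) ^ (-β) := integral_nonneg fun ω => by positivity
  set J : ℝ := (2 * π) ^ (-(d : ℝ) / 2) * (1 + 3 * L) ^ 2 * 2 ^ β *
      ∫ ω : Eucl d, (1 + ‖ω‖) ^ (-β) with hJ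
  have hJnn : 0 ≤ J := by positivity
  refine ⟨h₀, A * J * K ^ (β - d) + 1, hh₀, by positivity, ?_⟩
  intro X hX hXΩ hh ε hε x hx
  have hpos := fillDistance_pos hΩ hc hX hXΩ
  obtain ⟨a, haL, hloc, hmom⟩ := hrep X hX hXΩ hh x hx
  have hs := h.scaled hε
  have hsi := integrable_scaled_density hψ hε
  have hq := quasiMeasurePreserving_const_smul (d := d) (inv_ne_zero hε.ne')
  have hs0 : 0 ≤ᵐ[volume] fun ω => (ε ^ d)⁻¹ * ψ (ε⁻¹ • ω) := by
    filter_upwards [hq.ae h0] with ω hω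
    exact mul_nonneg (by positivity) hω
  have hsle : ∀ᵐ ω : Eucl d, (ε ^ d)⁻¹ * ψ (ε⁻¹ • ω) ≤ (A * ε ^ (β - d)) * ‖ω‖ ^ (-β) := by
    have hne : ∀ᵐ ω : Eucl d, ω ≠ 0 := by
      simp [ae_iff]
    filter_upwards [hq.ae hle, hne] with ω hω hω0
    have h1 := hω (smul_ne_zero (inv_ne_zero hε.ne') hω0)
    rw [norm_smul, Real.norm_eq_abs, abs_of_pos (by positivity),
      Real.mul_rpow (by positivity) (norm_nonneg _), Real.inv_rpow hε.le, Real.rpow_neg hε.le,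
      inv_inv] at h1
    calc (ε ^ d)⁻¹ * ψ (ε⁻¹ • ω) ≤ (ε ^ d)⁻¹ * (A * (ε ^ β * ‖ω‖ ^ (-β))) := by gcongr
      _ = _ := by rw [Real.rpow_sub hε, Real.rpow_natCast]; ring
  have hβℓ : β ≤ 2 * (⌈β⌉₊ : ℝ) := by
    have h1 := Nat.le_ceil β
    have h2 : (0 : ℝ) ≤ (⌈β⌉₊ : ℝ) := Nat.cast_nonneg _
    linarith
  have hkey := hs.functionalNormSq_le hsi hβ (by positivity) hsle (mul_pos hK hpos) hβℓ haL hloc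
    hmom
  refine ((powerFunction_sq_le (fun b => hs.functionalNormSq_nonneg hsi hs0 X x b) a).trans
    hkey).trans ?_
  rw [← hJ, Real.mul_rpow hK.le hpos.le]
  calc A * ε ^ (β - d) * (J * (K ^ (β - d) * fillDistance Ω X ^ (β - d)))
      = (A * J * K ^ (β - d)) * ε ^ (β - d) * fillDistance Ω X ^ (β - d) := by ring
    _ ≤ _ := by
      gcongr
      linarith

theorem iSup_powerFunction_le {Ω : Set (Eucl d)} {Φ : Eucl d → ℝ} {X : Finset (Eucl d)} {B : ℝ}
    (h : ∀ x ∈ Ω, powerFunction Φ X x ^ 2 ≤ B) :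
    BddAbove (Set.range fun x : Ω => powerFunction Φ X x) ∧
      (⨆ x : Ω, powerFunction Φ X x) ≤ √B := by
  have h' : ∀ x : Ω, powerFunction Φ X x ≤ √B := fun x => Real.le_sqrt_of_sq_le (h x x.2)
  exact ⟨⟨√B, by rintro _ ⟨x, rfl⟩; exact h' x⟩, Real.iSup_le h' (Real.sqrt_nonneg _)⟩

/-! ### Kernels of finite smoothness -/

/-- The Fourier transform of a kernel of finite smoothness is equivalent to
`(1 + ‖ω‖)^{-β}`. -/
theorem IsFiniteSmoothness.exists_bounds {Φ : Eucl d → ℝ} {β : ℝ} (h : IsFiniteSmoothness Φ β)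
    (hβ : 0 < β) : ∃ a A : ℝ, 0 < a ∧ 0 < A ∧ ∀ᵐ ω,
      a * (1 + ‖ω‖) ^ (-β) ≤ (fourierHat Φ ω).re ∧
      (fourierHat Φ ω).re ≤ A * (1 + ‖ω‖) ^ (-β) := by
  obtain ⟨c, C₀, C₁, c₀, c₁, hc, hC₀, hc₀, hb⟩ := h.bounds
  have key : ∀ t : ℝ, c ≤ t → (1 + t) ^ (-β) ≤ t ^ (-β) ∧
      t ^ (-β) ≤ (c / (1 + c)) ^ (-β) * (1 + t) ^ (-β) := by
    intro t ht
    have ht0 : 0 < t := hc.trans_le ht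
    refine ⟨Real.rpow_le_rpow_of_nonpos ht0 (by linarith) (by linarith), ?_⟩
    rw [← Real.mul_rpow (by positivity) (by positivity)]
    refine Real.rpow_le_rpow_of_nonpos (by positivity) ?_ (by linarith)
    rw [div_mul_eq_mul_div, div_le_iff₀ (by positivity)]
    nlinarith
  have key' : ∀ t : ℝ, 0 ≤ t → t ≤ c → (1 + t) ^ (-β) ≤ 1 ∧ (1 + c) ^ (-β) ≤ (1 + t) ^ (-β) := by
    intro t ht htc
    exact ⟨Real.rpow_le_one_of_one_le_of_nonpos (by linarith) (by linarith),
      Real.rpow_le_rpow_of_nonpos (by positivity) (by linarith) (by linarith)⟩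
  set B : ℝ := (c / (1 + c)) ^ (-β) with hB
  have hB0 : 0 < B := by positivity
  set B' : ℝ := (1 + c) ^ (-β) with hB'
  have hB'0 : 0 < B' := by positivity
  -- `C₁` and `c₁` are not assumed positive, hence the absolute values
  refine ⟨min C₀ c₀, |C₁| / B' + |c₁| * B + 1, lt_min hC₀ hc₀, by positivity, ?_⟩
  filter_upwards [hb] with ω hω
  have hp : 0 < (1 + ‖ω‖) ^ (-β) := by positivity
  rcases le_total ‖ω‖ c with hle | hle
  · obtain ⟨h1, h2⟩ := hω.1 hle
    obtain ⟨h3, h4⟩ := key' _ (norm_nonneg ω) hle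
    constructor
    · refine le_trans ?_ h1
      calc min C₀ c₀ * (1 + ‖ω‖) ^ (-β) ≤ C₀ * 1 :=
            mul_le_mul (min_le_left _ _) h3 hp.le hC₀.le
        _ = C₀ := mul_one _
    · refine h2.trans ((le_abs_self C₁).trans ?_)
      calc |C₁| = |C₁| / B' * B' := by field_simp
        _ ≤ |C₁| / B' * (1 + ‖ω‖) ^ (-β) := by gcongr
        _ ≤ _ := mul_le_mul_of_nonneg_right
          (by have : 0 ≤ |c₁| * B := by positivity
              linarith) hp.le
  · obtain ⟨h1, h2⟩ := hω.2 hle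
    obtain ⟨h3, h4⟩ := key _ hle
    constructor
    · refine le_trans ?_ h1
      exact mul_le_mul (min_le_right _ _) h3 hp.le hc₀.le
    · refine h2.trans ?_
      calc c₁ * ‖ω‖ ^ (-β) ≤ |c₁| * (B * (1 + ‖ω‖) ^ (-β)) :=
            mul_le_mul (le_abs_self _) h4 (by positivity) (abs_nonneg _)
        _ = |c₁| * B * (1 + ‖ω‖) ^ (-β) := by ring
        _ ≤ _ := mul_le_mul_of_nonneg_right
          (by have : 0 ≤ |C₁| / B' := by positivity
              linarith) hp.le

/-- Dilation by `ε⁻¹` costs a factor of at most `ε^β` for `ε ≤ 1`, and none for `ε ≥ 1`. -/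
theorem one_add_div_rpow_neg_ge {β ε t : ℝ} (hβ : 0 < β) (hε : 0 < ε) (ht : 0 ≤ t) :
    (ε ≤ 1 → ε ^ β * (1 + t) ^ (-β) ≤ (1 + ε⁻¹ * t) ^ (-β)) ∧
      (1 ≤ ε → (1 + t) ^ (-β) ≤ (1 + ε⁻¹ * t) ^ (-β)) := by
  constructor
  · intro h1
    have e : ε ^ β = (ε⁻¹) ^ (-β) := by rw [Real.inv_rpow hε.le, Real.rpow_neg hε.le, inv_inv]
    rw [e, ← Real.mul_rpow (by positivity) (by positivity)]
    refine Real.rpow_le_rpow_of_nonpos (by positivity) ?_ (by linarith)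
    have : 1 ≤ ε⁻¹ := (one_le_inv₀ hε).2 h1
    linarith
  · intro h1
    refine Real.rpow_le_rpow_of_nonpos (by positivity) ?_ (by linarith)
    have : ε⁻¹ ≤ 1 := inv_le_one_of_one_le₀ h1
    nlinarith

theorem finiteSmoothness_errorBound (hd : 1 ≤ d) {Ω : Set (Eucl d)}
    (hΩ : Bornology.IsBounded Ω) (hc : InteriorCone Ω) {Φ : Eucl d → ℝ} {β : ℝ}
    (hβ : (d : ℝ) < β) (hΦ : IsFiniteSmoothness Φ β) :
    ∃ h₀ C : ℝ, 0 < h₀ ∧ 0 < C ∧ ∀ X : Finset (Eucl d), X.Nonempty → (X : Set (Eucl d)) ⊆ Ω →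
      fillDistance Ω X ≤ h₀ → ∀ f : Eucl d → ℝ, MemNative Φ f → ∀ ε : ℝ, 0 < ε →
        MemNative (scaled ε Φ) f ∧
        BddAbove (Set.range fun x : Ω => powerFunction (scaled ε Φ) X x) ∧
        (ε ≤ 1 → uniformErrorBound Ω (scaled ε Φ) X f ≤ C * nativeNorm Φ f) ∧
        (1 ≤ ε → uniformErrorBound Ω (scaled ε Φ) X f ≤ C * ε ^ β * nativeNorm Φ f) := by
  have hβ0 : 0 < β := lt_of_le_of_lt (Nat.cast_nonneg d) hβ
  obtain ⟨a, A, ha, hA, hb⟩ := hΦ.exists_bounds hβ0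
  set ψ : Eucl d → ℝ := fun ω => (fourierHat Φ ω).re with hψdef
  have hψpos : ∀ᵐ ω, 0 < ψ ω := hb.mono fun ω hω => lt_of_lt_of_le (by positivity) hω.1
  have hψ : Integrable ψ := by
    refine ((integrable_one_add_norm (E := Eucl d) (μ := volume) (r := β)
      (by simpa using hβ)).const_mul A).mono'
      (Complex.measurable_re.comp_aemeasurable
        (aestronglyMeasurable_fourierHat Φ).aemeasurable).aestronglyMeasurable ?_
    filter_upwards [hb, hψpos] with ω hω hω0
    rw [Real.norm_eq_abs, abs_of_pos hω0]
    exact hω.2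
  have hψ2 : MemLp ψ 2 := by
    refine memLp_two_of_integrable_of_bounded hψ (A := A) ?_
    filter_upwards [hb, hψpos] with ω hω hω0
    rw [abs_of_pos hω0]
    refine hω.2.trans (mul_le_of_le_one_right hA.le ?_)
    exact Real.rpow_le_one_of_one_le_of_nonpos (by linarith [norm_nonneg ω]) (by linarith)
  have hdens : HasDensity Φ ψ := hasDensity_of_fourierHat hΦ.continuous hΦ.memLp hΦ.real hψ
  obtain ⟨h₀, D, hh₀, hD, hP⟩ := exists_powerFunction_scaled_sq_le hd hΩ hc hdens hψ
    (hψpos.mono fun ω hω => hω.le) hβ hA.le (hb.mono fun ω hω hω0 => hω.2.trans (by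
      have : 0 < ‖ω‖ := norm_pos_iff.2 hω0
      refine mul_le_mul_of_nonneg_left ?_ hA.le
      exact Real.rpow_le_rpow_of_nonpos this (by linarith) (by linarith)))
  -- domination of `Φ̂` by the Fourier transform of the scaled kernel
  have hdom : ∀ ε : ℝ, 0 < ε → ∀ s : ℝ, 0 < s →
      (∀ t : ℝ, 0 ≤ t → s * (1 + t) ^ (-β) ≤ (ε ^ d)⁻¹ * (1 + ε⁻¹ * t) ^ (-β)) →
      ∀ᵐ ω, 0 < (fourierHat Φ ω).re ∧
        (a / A * s) * (fourierHat Φ ω).re ≤ (fourierHat (scaled ε Φ) ω).re := by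
    intro ε hε s hs hst
    filter_upwards [hb, hψpos, hdens.fourierHat_scaled_re hψ hψ2 hε,
      (quasiMeasurePreserving_const_smul (inv_ne_zero hε.ne')).ae hb] with ω h1 h2 h3 h4
    refine ⟨h2, ?_⟩
    rw [h3]
    have h5 := hst ‖ω‖ (norm_nonneg ω)
    have h6 := h4.1
    rw [norm_smul, Real.norm_eq_abs, abs_of_pos (by positivity)] at h6
    calc a / A * s * (fourierHat Φ ω).re ≤ a / A * s * (A * (1 + ‖ω‖) ^ (-β)) := by
          gcongr
          exact h1.2
      _ = a * (s * (1 + ‖ω‖) ^ (-β)) := by field_simp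
      _ ≤ a * ((ε ^ d)⁻¹ * (1 + ε⁻¹ * ‖ω‖) ^ (-β)) := by gcongr
      _ = (ε ^ d)⁻¹ * (a * (1 + ε⁻¹ * ‖ω‖) ^ (-β)) := by ring
      _ ≤ _ := by gcongr
  have hsmall : ∀ ε : ℝ, 0 < ε → ε ≤ 1 → ∀ t : ℝ, 0 ≤ t →
      ε ^ (β - d) * (1 + t) ^ (-β) ≤ (ε ^ d)⁻¹ * (1 + ε⁻¹ * t) ^ (-β) := by
    intro ε hε h1 t ht
    have := (one_add_div_rpow_neg_ge hβ0 hε ht).1 h1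
    calc ε ^ (β - d) * (1 + t) ^ (-β) = (ε ^ d)⁻¹ * (ε ^ β * (1 + t) ^ (-β)) := by
          rw [Real.rpow_sub hε, Real.rpow_natCast]; ring
      _ ≤ _ := by gcongr
  have hlarge : ∀ ε : ℝ, 0 < ε → 1 ≤ ε → ∀ t : ℝ, 0 ≤ t →
      (ε ^ d)⁻¹ * (1 + t) ^ (-β) ≤ (ε ^ d)⁻¹ * (1 + ε⁻¹ * t) ^ (-β) := by
    intro ε hε h1 t ht
    have := (one_add_div_rpow_neg_ge hβ0 hε ht).2 h1
    gcongr
  set D' : ℝ := D * h₀ ^ (β - d) with hD'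
  have hD'0 : 0 < D' := by positivity
  refine ⟨h₀, √(D' * (a / A)⁻¹), hh₀, by positivity, ?_⟩
  intro X hX hXΩ hh f hf ε hε
  have hpos := fillDistance_pos hΩ hc hX hXΩ
  have hPε : ∀ x ∈ Ω, powerFunction (scaled ε Φ) X x ^ 2 ≤ D' * ε ^ (β - d) := by
    intro x hx
    refine (hP X hX hXΩ hh ε hε x hx).trans ?_
    calc D * ε ^ (β - d) * fillDistance Ω X ^ (β - d)
        ≤ D * ε ^ (β - d) * h₀ ^ (β - d) := by
          have := Real.rpow_le_rpow hpos.le hh (show 0 ≤ β - d by linarith)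
          gcongr
      _ = _ := by rw [hD']; ring
  obtain ⟨hbdd, hsup⟩ := iSup_powerFunction_le hPε
  have hN := nativeNorm_nonneg Φ f
  have hcomb : ∀ s : ℝ, 0 < s → nativeNorm (scaled ε Φ) f ≤ √((a / A * s)⁻¹) * nativeNorm Φ f →
      uniformErrorBound Ω (scaled ε Φ) X f ≤
        √(D' * (a / A)⁻¹) * √(ε ^ (β - d) * s⁻¹) * nativeNorm Φ f := by
    intro s hs hle
    rw [uniformErrorBound]
    calc _ ≤ √(D' * ε ^ (β - d)) * (√((a / A * s)⁻¹) * nativeNorm Φ f) :=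
          mul_le_mul hsup hle (nativeNorm_nonneg _ _) (Real.sqrt_nonneg _)
      _ = _ := by
          rw [← mul_assoc, ← Real.sqrt_mul (by positivity), ← Real.sqrt_mul (by positivity)]
          congr 2
          rw [mul_inv]; ring
  have h1 : ε ≤ 1 → MemNative (scaled ε Φ) f ∧
      uniformErrorBound Ω (scaled ε Φ) X f ≤ √(D' * (a / A)⁻¹) * nativeNorm Φ f := by
    intro hε1
    have hs : 0 < ε ^ (β - d) := by positivity
    obtain ⟨hm, hn⟩ := hf.of_le (by positivity) (hdom ε hε _ hs (hsmall ε hε hε1))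
    refine ⟨hm, (hcomb _ hs hn).trans_eq ?_⟩
    rw [mul_inv_cancel₀ hs.ne', Real.sqrt_one, mul_one]
  have h2 : 1 ≤ ε → MemNative (scaled ε Φ) f ∧
      uniformErrorBound Ω (scaled ε Φ) X f ≤ √(D' * (a / A)⁻¹) * ε ^ β * nativeNorm Φ f := by
    intro hε1
    have hs : 0 < (ε ^ d)⁻¹ := by positivity
    obtain ⟨hm, hn⟩ := hf.of_le (by positivity) (hdom ε hε _ hs (hlarge ε hε hε1))
    refine ⟨hm, (hcomb _ hs hn).trans ?_⟩
    have e : ε ^ (β - d) * ((ε ^ d)⁻¹)⁻¹ = ε ^ β := by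
      rw [inv_inv, ← Real.rpow_natCast, ← Real.rpow_add hε]; congr 1; ring
    have e1 : √(ε ^ β) ≤ ε ^ β := by
      have h1 : 1 ≤ ε ^ β := Real.one_le_rpow hε1 hβ0.le
      exact Real.sqrt_le_left (by positivity) |>.2 (by nlinarith)
    rw [e]
    gcongr
  exact ⟨(le_total ε 1).elim (fun h => (h1 h).1) (fun h => (h2 h).1), hbdd,
    fun h => (h1 h).2, fun h => (h2 h).2⟩

/-! ### Whittle–Matérn kernels -/

/-- For `ε ≤ 1`, the density of the scaled kernel dominates the unscaled one times
`ε^{2m-d}`. -/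
theorem le_scaled_maternDensity {m : ℕ} {ε : ℝ} (hε : 0 < ε) (hε1 : ε ≤ 1) (ω : Eucl d) :
    ε ^ (2 * (m : ℝ) - d) * ((1 + ‖ω‖ ^ 2) ^ m)⁻¹ ≤
      (ε ^ d)⁻¹ * maternDensity d m (ε⁻¹ • ω) := by
  have e : ε ^ (2 * (m : ℝ) - d) = (ε ^ d)⁻¹ * ε ^ (2 * m) := by
    rw [Real.rpow_sub hε, Real.rpow_natCast, div_eq_inv_mul, ← Real.rpow_natCast ε (2 * m)]
    push_cast; rfl
  rw [e, mul_assoc, maternDensity, norm_smul, Real.norm_eq_abs, abs_of_pos (by positivity)]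
  refine mul_le_mul_of_nonneg_left ?_ (by positivity)
  rw [← div_eq_mul_inv, div_le_iff₀ (by positivity), inv_mul_eq_div, le_div_iff₀ (by positivity),
    pow_mul, ← mul_pow]
  refine pow_le_pow_left₀ (by positivity) ?_ m
  have : ε ^ 2 * (1 + (ε⁻¹ * ‖ω‖) ^ 2) = ε ^ 2 + ‖ω‖ ^ 2 := by field_simp
  rw [this]
  gcongr
  exact pow_le_one₀ hε.le hε1

/-- By the binomial theorem, the native space norm of the scaled Whittle–Matérn kernel is a
combination of Sobolev seminorms. -/
theorem memNative_scaled_maternKernel {m : ℕ} (hm : (d : ℝ) / 2 < m) {f : Eucl d → ℝ}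
    (hf : MemW2 m f) {ε : ℝ} (hε : 0 < ε) :
    MemNative (scaled ε (maternKernel d m)) f ∧
      nativeNorm (scaled ε (maternKernel d m)) f ^ 2 =
        ε ^ ((d : ℝ) - 2 * m) * sobolevScale m f ε := by
  have hψ := integrable_maternDensity hm
  have hψ2 : MemLp (maternDensity d m) 2 := memLp_two_of_integrable_of_bounded hψ (A := 1)
    (Filter.Eventually.of_forall fun ω => by
      rw [abs_of_pos (maternDensity_pos m ω)]; exact maternDensity_le_one m ω)
  have hre := (hasDensity_maternKernel hm).fourierHat_scaled_re hψ hψ2 hε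
  have hterm : ∀ᵐ ω, ‖fourierHat f ω‖ ^ 2 / (fourierHat (scaled ε (maternKernel d m)) ω).re =
      ∑ j ∈ Finset.range (m + 1), ε ^ d * ((m.choose j : ℝ) * (ε ^ (2 * j))⁻¹) *
        (‖fourierHat f ω‖ ^ 2 * ‖ω‖ ^ (2 * j)) := by
    filter_upwards [hre] with ω hω
    rw [hω, maternDensity, norm_smul, Real.norm_eq_abs, abs_of_pos (by positivity), add_comm,
      add_pow]
    simp only [one_pow, mul_one]
    rw [← mul_inv, div_inv_eq_mul, Finset.mul_sum, Finset.mul_sum]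
    refine Finset.sum_congr rfl fun j _ => ?_
    rw [← pow_mul, mul_pow, inv_pow]
    ring
  have hint : ∀ j ∈ Finset.range (m + 1), Integrable (fun ω : Eucl d =>
      ε ^ d * ((m.choose j : ℝ) * (ε ^ (2 * j))⁻¹) *
        (‖fourierHat f ω‖ ^ 2 * ‖ω‖ ^ (2 * j))) := fun j hj =>
    (hf.integrable_sobolevSeminorm (Nat.lt_succ_iff.1 (Finset.mem_range.1 hj))).const_mul _
  have hI : Integrable (fun ω => ‖fourierHat f ω‖ ^ 2 /
      (fourierHat (scaled ε (maternKernel d m)) ω).re) :=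
    (integrable_finsetSum _ hint).congr (hterm.mono fun ω hω => hω.symm)
  have hκ : 0 ≤ (2 * π) ^ (-(d : ℝ) / 2) := by positivity
  have hsemi : ∀ j, sobolevSeminorm j f ^ 2 =
      (2 * π) ^ (-(d : ℝ) / 2) * ∫ ω, ‖fourierHat f ω‖ ^ 2 * ‖ω‖ ^ (2 * j) := fun j =>
    Real.sq_sqrt (mul_nonneg hκ (integral_nonneg fun ω => by positivity))
  refine ⟨⟨hf.1, hf.memLp, hI⟩, ?_⟩
  have hnn : 0 ≤ ∫ ω, ‖fourierHat f ω‖ ^ 2 / (fourierHat (scaled ε (maternKernel d m)) ω).re := by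
    refine integral_nonneg_of_ae ?_
    filter_upwards [hterm] with ω hω
    rw [hω]
    exact Finset.sum_nonneg fun j _ => by positivity
  have he : ε ^ ((d : ℝ) - 2 * m) * ε ^ (2 * m) = ε ^ d := by
    rw [← Real.rpow_natCast ε (2 * m), ← Real.rpow_natCast ε d, ← Real.rpow_add hε]
    congr 1; push_cast; ring
  rw [nativeNorm, Real.sq_sqrt (mul_nonneg hκ hnn), integral_congr_ae hterm,
    integral_finsetSum _ hint, sobolevScale, ← mul_assoc, he, Finset.mul_sum, Finset.mul_sum]
  refine Finset.sum_congr rfl fun j _ => ?_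
  rw [integral_const_mul, hsemi]
  ring

theorem maternKernel_errorBound (hd : 1 ≤ d) {Ω : Set (Eucl d)}
    (hΩ : Bornology.IsBounded Ω) (hc : InteriorCone Ω) {m : ℕ} (hm : (d : ℝ) / 2 < m) :
    ∃ h₀ c C : ℝ, 0 < h₀ ∧ 0 < c ∧ 0 < C ∧
      ∀ X : Finset (Eucl d), X.Nonempty → (X : Set (Eucl d)) ⊆ Ω → fillDistance Ω X ≤ h₀ →
        ∀ f : Eucl d → ℝ, MemW2 m f → ∀ ε : ℝ, 0 < ε → ε ≤ 1 →
          MemNative (scaled ε (maternKernel d m)) f ∧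
          BddAbove (Set.range fun x : Ω => powerFunction (scaled ε (maternKernel d m)) X x) ∧
          c * fillDistance Ω X ^ (2 * (m : ℝ) - d) * sobolevScale m f ε ≤
            uniformErrorBound Ω (scaled ε (maternKernel d m)) X f ^ 2 ∧
          uniformErrorBound Ω (scaled ε (maternKernel d m)) X f ^ 2 ≤
            C * fillDistance Ω X ^ (2 * (m : ℝ) - d) * sobolevScale m f ε ∧
          ∀ x ∈ Ω, c * Metric.infDist x (X : Set (Eucl d)) ^ (2 * (m : ℝ) - d) *
              sobolevScale m f ε ≤ errorBound (scaled ε (maternKernel d m)) X f x ^ 2 := by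
  set s : ℝ := 2 * (m : ℝ) - d with hs
  have hs0 : 0 < s := by rw [hs]; linarith
  have hψ := integrable_maternDensity hm
  have hdens := hasDensity_maternKernel hm
  have hupper : ∀ ω : Eucl d, ω ≠ 0 → maternDensity d m ω ≤ 1 * ‖ω‖ ^ (-(2 * (m : ℝ))) := by
    intro ω hω
    have h0 : 0 < ‖ω‖ := norm_pos_iff.2 hω
    have e : ‖ω‖ ^ (-(2 * (m : ℝ))) = ((‖ω‖ ^ 2) ^ m)⁻¹ := by
      rw [Real.rpow_neg h0.le, ← pow_mul, ← Real.rpow_natCast]; push_cast; rfl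
    rw [one_mul, e, maternDensity]
    refine inv_anti₀ (by positivity) (pow_le_pow_left₀ (by positivity) (by linarith) m)
  obtain ⟨h₀, D, hh₀, hD, hP⟩ := exists_powerFunction_scaled_sq_le hd hΩ hc hdens hψ
    (Filter.Eventually.of_forall fun ω => (maternDensity_pos m ω).le)
    (show (d : ℝ) < 2 * (m : ℝ) by linarith) zero_le_one (Filter.Eventually.of_forall hupper)
  obtain ⟨c, hc0, hlow⟩ := exists_le_functionalNormSq d m hh₀
  refine ⟨h₀, c * (1 / 2) ^ s, D, hh₀, by positivity, hD, ?_⟩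
  intro X hX hXΩ hh f hf ε hε hε1
  have hpos := fillDistance_pos hΩ hc hX hXΩ
  obtain ⟨hmem, hnorm⟩ := memNative_scaled_maternKernel hm hf hε
  set Φ := scaled ε (maternKernel d m) with hΦ
  set h := fillDistance Ω X with hhdef
  set S := sobolevScale m f ε with hS
  have hS0 : 0 ≤ S := by
    rw [hS, sobolevScale]
    refine mul_nonneg (by positivity) (Finset.sum_nonneg fun j _ => by positivity)
  have hup : ∀ x ∈ Ω, powerFunction Φ X x ^ 2 ≤ D * ε ^ s * h ^ s := hP X hX hXΩ hh ε hε
  obtain ⟨hbdd, hsup⟩ := iSup_powerFunction_le hup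
  have hεs : ε ^ s * ε ^ ((d : ℝ) - 2 * m) = 1 := by
    rw [← Real.rpow_add hε, hs]
    simp
  have hsdens := hdens.scaled hε
  have hsint := integrable_scaled_density hψ hε
  have hpt : ∀ x ∈ Ω, c * ε ^ s * Metric.infDist x (X : Set (Eucl d)) ^ s ≤
      powerFunction Φ X x ^ 2 := by
    intro x hx
    -- on `X` itself the bound is trivial, as `0 ^ s = 0` for `s > 0`
    rcases (Metric.infDist_nonneg (x := x) (s := (X : Set (Eucl d)))).eq_or_lt with hq | hq
    · rw [← hq, Real.zero_rpow hs0.ne', mul_zero]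
      positivity
    · refine le_powerFunction_sq (by positivity) fun a => ?_
      refine hlow Φ _ hsdens hsint _ (by positivity) (Filter.Eventually.of_forall
        (le_scaled_maternDensity hε hε1)) X x a _ hq
        ((infDist_le_fillDistance hΩ hX hx).trans hh) ?_
      intro y hy
      rw [← dist_eq_norm, dist_comm]
      exact Metric.infDist_le_dist_of_mem hy
  have hΩne : Nonempty Ω := by
    obtain ⟨x, hx⟩ := hX
    exact ⟨⟨x, hXΩ hx⟩⟩
  refine ⟨hmem, hbdd, ?_, ?_, fun x hx => ?_⟩
  · -- a point of `Ω` at distance at least `h / 2` from `X`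
    obtain ⟨x, hx⟩ := exists_lt_of_lt_ciSup (show h / 2 < h by linarith)
    have h1 : h / 2 ≤ Metric.infDist (x : Eucl d) (X : Set (Eucl d)) := hx.le
    have hle : powerFunction Φ X x ≤ ⨆ x : Ω, powerFunction Φ X x := le_ciSup hbdd x
    have h2 := hpt x x.2
    have h3 : (h / 2) ^ s ≤ Metric.infDist (x : Eucl d) (X : Set (Eucl d)) ^ s :=
      Real.rpow_le_rpow (by positivity) h1 hs0.le
    have e : (h / 2) ^ s = (1 / 2) ^ s * h ^ s := by
      rw [← Real.mul_rpow (by norm_num) hpos.le]; congr 1; ring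
    rw [uniformErrorBound, mul_pow, hnorm]
    calc c * (1 / 2) ^ s * h ^ s * S
        = (c * ε ^ s * (h / 2) ^ s) * (ε ^ ((d : ℝ) - 2 * m) * S) := by
          rw [e]
          linear_combination (-(c * (1 / 2) ^ s * h ^ s * S)) * hεs
      _ ≤ (⨆ x : Ω, powerFunction Φ X x) ^ 2 * (ε ^ ((d : ℝ) - 2 * m) * S) := by
          refine mul_le_mul_of_nonneg_right ?_ (by positivity)
          calc c * ε ^ s * (h / 2) ^ s ≤
              c * ε ^ s * Metric.infDist (x : Eucl d) (X : Set (Eucl d)) ^ s := by gcongr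
            _ ≤ powerFunction Φ X x ^ 2 := h2
            _ ≤ _ := pow_le_pow_left₀ (Real.sqrt_nonneg _) hle 2
  · rw [uniformErrorBound, mul_pow, hnorm]
    have h1 : (⨆ x : Ω, powerFunction Φ X x) ^ 2 ≤ D * ε ^ s * h ^ s := by
      rw [← Real.sq_sqrt (show 0 ≤ D * ε ^ s * h ^ s by positivity)]
      exact pow_le_pow_left₀ (Real.iSup_nonneg fun _ => Real.sqrt_nonneg _) hsup 2
    calc _ ≤ (D * ε ^ s * h ^ s) * (ε ^ ((d : ℝ) - 2 * m) * S) :=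
          mul_le_mul_of_nonneg_right h1 (by positivity)
      _ = D * h ^ s * S := by linear_combination (D * h ^ s * S) * hεs
  · rw [errorBound, mul_pow, hnorm]
    have hi := Metric.infDist_nonneg (x := x) (s := (X : Set (Eucl d)))
    calc c * (1 / 2) ^ s * Metric.infDist x (X : Set (Eucl d)) ^ s * S
        ≤ c * 1 * Metric.infDist x (X : Set (Eucl d)) ^ s * S := by
          gcongr
          exact Real.rpow_le_one (by norm_num) (by norm_num) hs0.le
      _ = (c * ε ^ s * Metric.infDist x (X : Set (Eucl d)) ^ s) *
          (ε ^ ((d : ℝ) - 2 * m) * S) := by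
          linear_combination (-(c * Metric.infDist x (X : Set (Eucl d)) ^ s * S)) * hεs
      _ ≤ _ := mul_le_mul_of_nonneg_right (hpt x hx) (by positivity)

end RBFScaling

theorem mainTheorem5 {d : ℕ} (hd : 1 ≤ d) (Ω : Set (RBFScaling.Eucl d))
    (hΩb : Bornology.IsBounded Ω) (hΩc : RBFScaling.InteriorCone Ω) (γ : ℝ) :
    (∀ (Φ : RBFScaling.Eucl d → ℝ) (β : ℝ), (d : ℝ) < β → RBFScaling.IsFiniteSmoothness Φ β →
      ∃ h₀ C : ℝ, 0 < h₀ ∧ 0 < C ∧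
        ∀ X : Finset (RBFScaling.Eucl d), RBFScaling.UniformlyPlaced Ω γ X →
          RBFScaling.fillDistance Ω X ≤ h₀ →
          ∀ f : RBFScaling.Eucl d → ℝ, RBFScaling.MemNative Φ f → ∀ ε : ℝ, 0 < ε →
            RBFScaling.MemNative (RBFScaling.scaled ε Φ) f ∧
            BddAbove (Set.range fun x : Ω =>
              RBFScaling.powerFunction (RBFScaling.scaled ε Φ) X x) ∧
            (ε ≤ 1 → RBFScaling.uniformErrorBound Ω (RBFScaling.scaled ε Φ) X f ≤
              C * RBFScaling.nativeNorm Φ f) ∧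
            (1 ≤ ε → RBFScaling.uniformErrorBound Ω (RBFScaling.scaled ε Φ) X f ≤
              C * ε ^ β * RBFScaling.nativeNorm Φ f)) ∧
    (∀ m : ℕ, (d : ℝ) / 2 < m →
      ∃ h₀ c C : ℝ, 0 < h₀ ∧ 0 < c ∧ 0 < C ∧
        ∀ X : Finset (RBFScaling.Eucl d), RBFScaling.UniformlyPlaced Ω γ X →
          RBFScaling.fillDistance Ω X ≤ h₀ →
          ∀ f : RBFScaling.Eucl d → ℝ, RBFScaling.MemW2 m f → ∀ ε : ℝ, 0 < ε → ε ≤ 1 →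
            RBFScaling.MemNative (RBFScaling.scaled ε (RBFScaling.maternKernel d m)) f ∧
            BddAbove (Set.range fun x : Ω =>
              RBFScaling.powerFunction (RBFScaling.scaled ε (RBFScaling.maternKernel d m)) X x) ∧
            c * RBFScaling.fillDistance Ω X ^ (2 * (m : ℝ) - d) *
                RBFScaling.sobolevScale m f ε ≤
              RBFScaling.uniformErrorBound Ω
                (RBFScaling.scaled ε (RBFScaling.maternKernel d m)) X f ^ 2 ∧
            RBFScaling.uniformErrorBound Ω
                (RBFScaling.scaled ε (RBFScaling.maternKernel d m)) X f ^ 2 ≤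
              C * RBFScaling.fillDistance Ω X ^ (2 * (m : ℝ) - d) *
                RBFScaling.sobolevScale m f ε ∧
            ∀ x ∈ Ω,
              c * Metric.infDist x (X : Set (RBFScaling.Eucl d)) ^ (2 * (m : ℝ) - d) *
                  RBFScaling.sobolevScale m f ε ≤
                RBFScaling.errorBound
                  (RBFScaling.scaled ε (RBFScaling.maternKernel d m)) X f x ^ 2) := by
  constructor
  · intro Φ β hβ hΦ
    obtain ⟨h₀, C, hh₀, hC, h⟩ := RBFScaling.finiteSmoothness_errorBound hd hΩb hΩc hβ hΦ
    exact ⟨h₀, C, hh₀, hC, fun X hX hh => h X hX.nonempty hX.subset hh⟩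
  · intro m hm
    obtain ⟨h₀, c, C, hh₀, hc, hC, h⟩ := RBFScaling.maternKernel_errorBound hd hΩb hΩc hm
    exact ⟨h₀, c, C, hh₀, hc, hC, fun X hX hh => h X hX.nonempty hX.subset hh⟩
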